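/- Notation. For $f:\mathbb Z\to\mathbb R$ put $\Delta f(j)=f(j+1)-f(j)$, $\|f\|_1=\sum_{j\in\mathbb Z}|f(j)|$ and $\|f\|_\infty=\sup_{j\in\mathbb Z}|f(j)|$. For laws on $\mathbb Z$ with distribution functions $F,G$ put $d_{\mathrm{loc}}(F,G)=\|\Delta F-\Delta G\|_\infty$, $d_{\mathrm{TV}}(F,G)=\tfrac12\|\Delta F-\Delta G\|_1$ and $D_1(F)=\|\Delta^2F\|_1$. For laws on $\mathbb R$ with distribution functions $F,G$ put $d_{\mathrm K}(F,G)=\sup_{x\in\mathbb R}|F(x)-G(x)|$ and $d_{\mathrm W}(F,G)=\int_{\mathbb R}|F(x)-G(x)|\,dx$. Let $\Phi$ be the standard normal law. Let $\mathrm{TP}(\mu,\sigma^2)$ be the translated Poisson law, i.e. the law of $\lfloor\mu-\sigma^2\rfloor+X$ with $X\sim\mathrm{Po}(\sigma^2+\gamma)$ and $\gamma=\mu-\sigma^2-\lfloor\mu-\sigma^2\rfloor$. Theorem. Let $W=W(\sigma)$ be a family of integer-valued random variables with $\operatorname{Var}W=\sigma^2<\infty$ and $\sigma\to\infty$ along the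 family. Suppose that for each member of the family there are a sub-$\sigma$-algebra $\mathcal F$ of the underlying probability space and a decomposition $W=Y+\sum_{i=1}^N Z_i$ almost surely, where $N$ is an $\mathcal F$-measurable random variable with values in $\{0,1,2,\dots\}$, where $Y,Z_1,Z_2,\dots$ are integer-valued random variables, and where, conditionally on $\mathcal F$, the variables $Y,Z_1,\dots,Z_N$ are independent. Let $u>0$ and $\beta>0$ be constants not depending on $\sigma$ such that, almost surely, $u\le 1-\tfrac12D_1(\mathscr L(Z_i\mid\mathcal F))$ for all $1\le i\le N$. Put $\widetilde W=(W-\mathbb EW)/\sigma$. (a) If $\mathbb P[N<\beta\sigma^2]=O(\sigma^{-k})$ as $\sigma\to\infty$ for some real $k\ge2$, then, as $\sigma\to\infty$, $$d_{\mathrm{loc}}\bigl(\mathscr L(W),\mathrm{TP}(\mathbb EW,\sigma^2)\bigr)=O\!\left(\frac{d_{\mathrm K}(\mathscr L(\widetilde W),\Phi)^{1-1/k}}{\sigma}\right)\quad\text{and}\quad d_{\mathrm{loc}}\bigl(\mathscr L(W),\mathrm{TP}(\mathbb EW,\sigma^2)\bigr)=O\!\left(\frac{d_{\mathrm W}(\mathscr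 L(\widetilde W),\Phi)^{1-2/(k+1)}}{\sigma}\right).$$ (b) If $\mathbb P[N<\beta\sigma^2]=O(\sigma^{-k})$ as $\sigma\to\infty$ for some real $k\ge1$, then, as $\sigma\to\infty$, $$d_{\mathrm{TV}}\bigl(\mathscr L(W),\mathrm{TP}(\mathbb EW,\sigma^2)\bigr)=O\!\left(d_{\mathrm W}(\mathscr L(\widetilde W),\Phi)^{k/(k+1)}\right).$$ -/

import Mathlib

open MeasureTheory ProbabilityTheory Filter Asymptotics

noncomputable section

/-! ### Norms and metrics -/

/-- The `ℓ¹` norm of a function on the integers (used for summable functions only). -/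
def l1Norm (f : ℤ → ℝ) : ℝ := ∑' j, |f j|

/-- The supremum norm of a function on the integers (used for bounded functions only). -/
def supNorm (f : ℤ → ℝ) : ℝ := ⨆ j, |f j|

/-- The distribution function, restricted to the integers, of a law on the integers. -/
def intCdf (μ : Measure ℤ) (j : ℤ) : ℝ := μ.real (Set.Iic j)

/-- The local metric `‖ΔF - ΔG‖_∞`, where `Δf(j) = f(j+1) - f(j)`. -/
def dLoc (μ ν : Measure ℤ) : ℝ :=
  supNorm (fun j => fwdDiff 1 (intCdf μ) j - fwdDiff 1 (intCdf ν) j)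

/-- The total variation metric `(1/2) ‖ΔF - ΔG‖_1`. -/
def dTV (μ ν : Measure ℤ) : ℝ :=
  1 / 2 * l1Norm (fun j => fwdDiff 1 (intCdf μ) j - fwdDiff 1 (intCdf ν) j)

/-- The Kolmogorov metric `‖F - G‖_∞` of two laws on the real line. -/
def dK (μ ν : Measure ℝ) : ℝ := ⨆ x : ℝ, |cdf μ x - cdf ν x|

/-- The Wasserstein metric `‖F - G‖_1` of two laws on the real line with finite mean. -/
def dW (μ ν : Measure ℝ) : ℝ := ∫ x : ℝ, |cdf μ x - cdf ν x|

/-- The measure of smoothness `D_n = ‖Δ^{n+1} F‖_1` of a law on the integers. -/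
def smoothD (n : ℕ) (μ : Measure ℤ) : ℝ := l1Norm ((fwdDiff (1 : ℤ))^[n + 1] (intCdf μ))

/-! ### The translated Poisson distribution -/

/-- The translated Poisson law `TP(a, s)` with `s ≥ 0` (where `s = σ²`): the law of
`⌊a - s⌋ + Po(s + γ)` with `γ = a - s - ⌊a - s⌋`. -/
def translatedPoisson (a s : ℝ) : Measure ℤ :=
  (poissonMeasure (s + Int.fract (a - s)).toNNReal).map (fun n : ℕ => (n : ℤ) + ⌊a - s⌋)

/-! ### Conditioning on a sub-σ-algebra -/

/-- The regular conditional law of `X` given the sub-σ-algebra `𝓕`. -/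
def condLaw {Ω S : Type*} [MeasurableSpace S] [StandardBorelSpace S] [Nonempty S]
    (𝓕 : MeasurableSpace Ω) [mΩ : MeasurableSpace Ω] (μ : Measure Ω) [IsFiniteMeasure μ]
    (X : Ω → S) (ω : Ω) : Measure S :=
  @condDistrib Ω Ω S _ _ _ mΩ 𝓕 X id μ _ ω

/-- The `n + 1` coordinates `y, z_0, …, z_{n-1}` of a point `(y, (z_j)_j)`. -/
def blockCoord (n : ℕ) : Option (Fin n) → ℤ × (ℕ → ℤ) → ℤ
  | none => fun p => p.1
  | some j => fun p => p.2 j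

end

/-!
Fix one member of the family, write `s = σ`, let `f` be the difference of the distribution functions
of `W` and of `TP(E W, s²)` on the integers, `Δ` the difference operator, and `A` the moving average
over a window of length `h`. The algebraic identity `1 = (1 - A²)^m + Q A²`, where `1 - A` is
divisible by `Δ` with a quotient of norm at most `h`, gives the smoothing inequality
(`smoothing_bound`)
`‖Δf‖ ≤ (2h)^m ‖Δ^(m+1) f₁‖ + 2^m ‖Δf₂‖ + 2^m ‖A² Δf‖`, `f = f₁ + f₂`,
in the supremum norm and in the `ℓ¹` norm. Here `f₂` comes from the part of the law of `W` on the
event `N < β s²`, so that `‖Δf₂‖` is at most the probability of that event.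

The first term is small because the law on `N ≥ β s²` is smooth. If a law and its translate by one
share the mass `u`, convolution with it contains the step `(1 + X) / 2` of the symmetric random walk
(`X` the shift) with weight `u`; since `(X - 1) ((1 + X) / 2)^j` has norm of order `j^(-1/2)`, a sum
of about `β s²` such variables gains a factor of order `1 / s` for each difference, once the sum is cut
into as many blocks as there are differences (`smoothBy_block`, `smoothBy_sum`). Conditioning on `𝓕`
transfers this to the law of `W` (`smoothBy_map_restrict`); the Poisson law is treated with the
Stein–Chen identity and its infinite divisibility (`smoothBy_translatedPoisson`).

The last term is at most `(2 / h) ‖f‖` in either norm, and at most `(2 / h²) ‖f‖₁` in the mixed case.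
Up to the factor `s`, the norms of `f` are the Kolmogorov and Wasserstein distances between the
standardised laws. The translated Poisson law is within `181 / s` of the normal law in both metrics,
by Stein's method (`abs_integral_poisson_sub_gaussian_le`), and any law on a lattice of span `1 / s` is
at least `c / s` away from the normal law (`le_dK_stdLaw`, `le_dW_stdLaw`). Hence the translated
Poisson law may be replaced by the normal law at the price of a constant.

With `d` the distance of the standardised law of `W` to the normal law, the window `h ≈ d^θ s`, with
`θ = 1 / k` for `d = dK` and `θ = 1 / (k + 1)` for `d = dW`, and about `k` differences give the three
rates (`exists_rate`); the probability of `N < β s²` does no harm because `1 / s ≤ d / c`.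
-/

noncomputable section

/-! ### Polynomials in the shift acting on functions on the integers -/

/-- The shift `(S f) j = f (j + 1)` on functions on the integers. -/
def shiftEnd : Module.End ℝ (ℤ → ℝ) := LinearMap.funLeft ℝ ℝ (fun j : ℤ => j + 1)

/-- The action of a polynomial `p` on functions on the integers, with `X` acting as the shift. -/
def shiftAct (p : Polynomial ℝ) : Module.End ℝ (ℤ → ℝ) := Polynomial.aeval shiftEnd p

lemma shiftEnd_apply (f : ℤ → ℝ) (j : ℤ) : shiftEnd f j = f (j + 1) := rfl

lemma shiftEnd_pow_apply (n : ℕ) (f : ℤ → ℝ) (j : ℤ) : (shiftEnd ^ n) f j = f (j + n) := by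
  induction n generalizing j with
  | zero => simp
  | succ n ih =>
    rw [pow_succ', Module.End.mul_apply, shiftEnd_apply, ih]
    push_cast; ring_nf

lemma shiftAct_mul_apply (p q : Polynomial ℝ) (f : ℤ → ℝ) :
    shiftAct (p * q) f = shiftAct p (shiftAct q f) := by
  simp [shiftAct]

lemma shiftAct_X_sub_one (f : ℤ → ℝ) : shiftAct (Polynomial.X - 1) f = fwdDiff 1 f := by
  ext j
  simp [shiftAct, shiftEnd_apply, fwdDiff]

lemma shiftAct_X_sub_one_pow (n : ℕ) (f : ℤ → ℝ) :
    shiftAct ((Polynomial.X - 1) ^ n) f = (fwdDiff (1 : ℤ))^[n] f := by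
  induction n with
  | zero => simp [shiftAct]
  | succ n ih =>
    rw [pow_succ', shiftAct_mul_apply, ih, shiftAct_X_sub_one, Function.iterate_succ_apply']

/-- A shift-invariant seminorm on functions on the integers, encoded by the relation
`B f c`: "the seminorm of `f` is at most `c`" (so that it may also take the value `∞`). -/
structure IsShiftNorm (B : (ℤ → ℝ) → ℝ → Prop) : Prop where
  add : ∀ {f g c d}, B f c → B g d → B (f + g) (c + d)
  smul : ∀ (a : ℝ) {f c}, B f c → B (a • f) (|a| * c)
  shift : ∀ {f c}, B f c → B (shiftEnd f) c

/-- `‖f‖_∞ ≤ c`. -/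
def SupBound (f : ℤ → ℝ) (c : ℝ) : Prop := ∀ j, |f j| ≤ c

/-- `‖f‖₁ ≤ c`. -/
def L1Bound (f : ℤ → ℝ) (c : ℝ) : Prop := ∀ s : Finset ℤ, ∑ j ∈ s, |f j| ≤ c

lemma isShiftNorm_supBound : IsShiftNorm SupBound where
  add hf hg j := (abs_add_le _ _).trans (add_le_add (hf j) (hg j))
  smul a f c hf j := by
    simpa [abs_mul] using mul_le_mul_of_nonneg_left (hf j) (abs_nonneg a)
  shift hf j := hf (j + 1)

lemma isShiftNorm_l1Bound : IsShiftNorm L1Bound where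
  add {f g c d} hf hg s := by
    calc ∑ j ∈ s, |(f + g) j| ≤ ∑ j ∈ s, (|f j| + |g j|) :=
          Finset.sum_le_sum fun j _ => abs_add_le _ _
      _ ≤ c + d := by rw [Finset.sum_add_distrib]; exact add_le_add (hf s) (hg s)
  smul a f c hf s := by
    simpa [abs_mul, ← Finset.mul_sum] using mul_le_mul_of_nonneg_left (hf s) (abs_nonneg a)
  shift {f c} hf s := by
    have := hf (s.map (addRightEmbedding 1))
    simpa [shiftEnd_apply] using this

/-- The polynomial `p` in the shift has operator norm at most `t` for the seminorm `B`. -/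
def OpBound (B : (ℤ → ℝ) → ℝ → Prop) (p : Polynomial ℝ) (t : ℝ) : Prop :=
  ∀ f c, B f c → B (shiftAct p f) (t * c)

namespace OpBound

variable {B : (ℤ → ℝ) → ℝ → Prop}

lemma add (hB : IsShiftNorm B) {p q : Polynomial ℝ} {t u : ℝ} (hp : OpBound B p t)
    (hq : OpBound B q u) : OpBound B (p + q) (t + u) := by
  intro f c hf
  have := hB.add (hp f c hf) (hq f c hf)
  rw [← add_mul] at this
  simpa [shiftAct] using this

lemma mul {p q : Polynomial ℝ} {t u : ℝ} (hp : OpBound B p t)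
    (hq : OpBound B q u) : OpBound B (p * q) (t * u) := by
  intro f c hf
  rw [shiftAct_mul_apply, mul_assoc]
  exact hp _ _ (hq f c hf)

lemma smul (hB : IsShiftNorm B) (a : ℝ) {p : Polynomial ℝ} {t : ℝ} (hp : OpBound B p t) :
    OpBound B (a • p) (|a| * t) := by
  intro f c hf
  have := hB.smul a (hp f c hf)
  rw [← mul_assoc] at this
  simpa [shiftAct] using this

lemma one : OpBound B 1 1 := by
  intro f c hf
  simpa [shiftAct] using hf

lemma zero (hB : IsShiftNorm B) : OpBound B 0 0 := by
  simpa using smul hB 0 (one (B := B))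

lemma X_pow (hB : IsShiftNorm B) (n : ℕ) : OpBound B (Polynomial.X ^ n) 1 := by
  induction n with
  | zero => simpa using one
  | succ n ih =>
    have hX : OpBound B Polynomial.X 1 := by
      intro f c hf
      simpa [shiftAct] using hB.shift hf
    simpa [pow_succ] using mul ih hX

lemma pow {p : Polynomial ℝ} {t : ℝ} (hp : OpBound B p t) (n : ℕ) : OpBound B (p ^ n) (t ^ n) := by
  induction n with
  | zero => simpa using one
  | succ n ih => simpa [pow_succ] using mul ih hp

lemma sum (hB : IsShiftNorm B) {κ : Type*} (s : Finset κ) {p : κ → Polynomial ℝ} {t : κ → ℝ}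
    (hp : ∀ i ∈ s, OpBound B (p i) (t i)) : OpBound B (∑ i ∈ s, p i) (∑ i ∈ s, t i) := by
  classical
  induction s using Finset.induction_on with
  | empty => simpa using zero hB
  | insert a s ha ih =>
    rw [Finset.sum_insert ha, Finset.sum_insert ha]
    exact add hB (hp _ (by simp)) (ih fun i hi => hp i (by simp [hi]))

lemma geom_sum (hB : IsShiftNorm B) (n : ℕ) :
    OpBound B (∑ i ∈ Finset.range n, Polynomial.X ^ i) n := by
  simpa using sum hB (Finset.range n) fun i _ => X_pow hB i

lemma X_pow_sub_one (hB : IsShiftNorm B) (n : ℕ) : OpBound B (Polynomial.X ^ n - 1) 2 := by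
  have := add hB (X_pow hB n) (smul hB (-1) one)
  have e : (1 : ℝ) + |(-1)| * 1 = 2 := by norm_num
  rw [e] at this
  simpa [sub_eq_add_neg] using this

end OpBound

/-! ### Smoothing by moving averages -/

/-- The moving average `h⁻¹ (1 + S + ⋯ + S^(h-1))`, as a polynomial in the shift `S`. -/
def movAvg (h : ℕ) : Polynomial ℝ := (h : ℝ)⁻¹ • ∑ i ∈ Finset.range h, Polynomial.X ^ i

lemma movAvg_mul_X_sub_one (h : ℕ) :
    movAvg h * (Polynomial.X - 1) = (h : ℝ)⁻¹ • (Polynomial.X ^ h - 1) := by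
  rw [movAvg, smul_mul_assoc, geom_sum_mul]

lemma opBound_movAvg {B : (ℤ → ℝ) → ℝ → Prop} (hB : IsShiftNorm B) {h : ℕ} (hh : 0 < h) :
    OpBound B (movAvg h) 1 := by
  have := (OpBound.geom_sum hB h).smul hB (h : ℝ)⁻¹
  have h0 : (0 : ℝ) < h := by exact_mod_cast hh
  rwa [abs_of_pos (inv_pos.2 h0), inv_mul_cancel₀ h0.ne'] at this

/-- `1 - A` is divisible by the difference operator, with a quotient of norm at most `h`. -/
lemma exists_one_sub_movAvg {B : (ℤ → ℝ) → ℝ → Prop} (hB : IsShiftNorm B) {h : ℕ} (hh : 0 < h)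
    (hmono : ∀ {f c d}, B f c → c ≤ d → B f d) (hnn : ∀ {f c}, B f c → 0 ≤ c) :
    ∃ R : Polynomial ℝ, 1 - movAvg h = R * (Polynomial.X - 1) ∧ OpBound B R h := by
  have h0 : (0 : ℝ) < h := by exact_mod_cast hh
  refine ⟨(-(h : ℝ)⁻¹) • ∑ i ∈ Finset.range h, ∑ l ∈ Finset.range i, Polynomial.X ^ l, ?_, ?_⟩
  · rw [smul_mul_assoc, Finset.sum_mul]
    simp_rw [geom_sum_mul]
    rw [Finset.sum_sub_distrib, movAvg, smul_sub]
    simp only [Finset.sum_const, Finset.card_range, neg_smul, sub_neg_eq_add, nsmul_eq_mul, mul_one]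
    have : (h : ℝ)⁻¹ • (h : Polynomial ℝ) = 1 := by
      rw [← Polynomial.C_eq_natCast, Polynomial.smul_C, smul_eq_mul, inv_mul_cancel₀ h0.ne',
        Polynomial.C_1]
    rw [this]; ring
  · have := (OpBound.sum hB (Finset.range h) fun i _ => OpBound.geom_sum hB i).smul hB (-(h : ℝ)⁻¹)
    intro f c hf
    refine hmono (this f c hf) (mul_le_mul_of_nonneg_right ?_ (hnn hf))
    rw [abs_neg, abs_of_pos (inv_pos.2 h0)]
    have h2 : ∑ i ∈ Finset.range h, (i : ℝ) ≤ h * h := by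
      calc ∑ i ∈ Finset.range h, (i : ℝ) ≤ ∑ i ∈ Finset.range h, (h : ℝ) :=
            Finset.sum_le_sum fun i hi => by exact_mod_cast (Finset.mem_range.1 hi).le
        _ = h * h := by simp
    calc (h : ℝ)⁻¹ * ∑ i ∈ Finset.range h, (i : ℝ) ≤ (h : ℝ)⁻¹ * (h * h) := by gcongr
      _ = h := by field_simp

/-- The smoothing inequality behind all three estimates. With `A` the moving average of length
`h`, write `Δf = (1 - A²)^m Δf + Q A² Δf`; in the first term the part `f₁` gains a factor
`h^m` from `m` further differences, while for the part `f₂` the trivial bound is used. -/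
lemma smoothing_bound {B : (ℤ → ℝ) → ℝ → Prop} (hB : IsShiftNorm B)
    (hmono : ∀ {f c d}, B f c → c ≤ d → B f d) (hnn : ∀ {f c}, B f c → 0 ≤ c)
    {h : ℕ} (hh : 0 < h) (m : ℕ) (f₁ f₂ : ℤ → ℝ) {K₁ K₂ K₃ : ℝ}
    (h₁ : B ((fwdDiff (1 : ℤ))^[m + 1] f₁) K₁) (h₂ : B (fwdDiff 1 f₂) K₂)
    (h₃ : B (shiftAct (movAvg h ^ 2 * (Polynomial.X - 1)) (f₁ + f₂)) K₃) :
    B (fwdDiff 1 (f₁ + f₂)) ((2 * h) ^ m * K₁ + 2 ^ m * K₂ + 2 ^ m * K₃) := by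
  set A := movAvg h
  have hA : OpBound B A 1 := opBound_movAvg hB hh
  obtain ⟨R, hR, hRb⟩ := exists_one_sub_movAvg hB hh hmono hnn
  have hA2 : OpBound B (1 - A ^ 2) 2 := by
    have := OpBound.one.add hB ((hA.pow 2).smul hB (-1))
    have e : (1 : ℝ) + |(-1)| * 1 ^ 2 = 2 := by norm_num
    rw [e] at this
    simpa [sub_eq_add_neg] using this
  have hfac : (1 - A ^ 2) ^ m = (R * (1 + A)) ^ m * (Polynomial.X - 1) ^ m := by
    rw [← mul_pow]
    congr 1
    calc 1 - A ^ 2 = (1 - A) * (1 + A) := by ring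
      _ = _ := by rw [hR]; ring
  have hRA : OpBound B ((R * (1 + A)) ^ m) ((2 * h) ^ m) := by
    refine OpBound.pow ?_ m
    have := hRb.mul (OpBound.one.add hB hA)
    have e : (h : ℝ) * (1 + 1) = 2 * h := by ring
    rwa [e] at this
  have hQ : OpBound B (∑ i ∈ Finset.range m, (1 - A ^ 2) ^ i) (2 ^ m) := by
    intro f c hf
    refine hmono (OpBound.sum hB _ (fun i _ => hA2.pow i) f c hf)
      (mul_le_mul_of_nonneg_right ?_ (hnn hf))
    have := geom_sum_mul (2 : ℝ) m
    linarith
  have hid : (1 - A ^ 2) ^ m + (∑ i ∈ Finset.range m, (1 - A ^ 2) ^ i) * A ^ 2 = 1 := by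
    have := geom_sum_mul (1 - A ^ 2) m
    linear_combination -this
  have key : fwdDiff 1 (f₁ + f₂) =
      shiftAct ((R * (1 + A)) ^ m) ((fwdDiff (1 : ℤ))^[m + 1] f₁) +
      shiftAct ((1 - A ^ 2) ^ m) (fwdDiff 1 f₂) +
      shiftAct (∑ i ∈ Finset.range m, (1 - A ^ 2) ^ i)
        (shiftAct (A ^ 2 * (Polynomial.X - 1)) (f₁ + f₂)) := by
    rw [← shiftAct_X_sub_one_pow, ← shiftAct_X_sub_one, ← shiftAct_X_sub_one, ← shiftAct_mul_apply,
      ← shiftAct_mul_apply, ← shiftAct_mul_apply, pow_succ, ← mul_assoc, ← hfac, ← mul_assoc,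
      map_add, map_add]
    have e : ∀ g : ℤ → ℝ, shiftAct (Polynomial.X - 1) g =
        shiftAct ((1 - A ^ 2) ^ m * (Polynomial.X - 1)) g +
        shiftAct ((∑ i ∈ Finset.range m, (1 - A ^ 2) ^ i) * A ^ 2 * (Polynomial.X - 1)) g := by
      intro g
      rw [← LinearMap.add_apply]
      congr 1
      simp only [shiftAct]
      rw [← map_add, ← add_mul, hid, one_mul]
    rw [e f₁, e f₂]
    abel
  rw [key]
  exact hB.add (hB.add (hRA _ _ h₁) (hA2.pow m _ _ h₂)) (hQ _ _ h₃)

lemma SupBound.nonneg {f : ℤ → ℝ} {c : ℝ} (h : SupBound f c) : 0 ≤ c := (abs_nonneg _).trans (h 0)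

lemma SupBound.mono {f : ℤ → ℝ} {c d : ℝ} (h : SupBound f c) (hcd : c ≤ d) : SupBound f d :=
  fun j => (h j).trans hcd

lemma L1Bound.nonneg {f : ℤ → ℝ} {c : ℝ} (h : L1Bound f c) : 0 ≤ c := by simpa using h ∅

lemma L1Bound.mono {f : ℤ → ℝ} {c d : ℝ} (h : L1Bound f c) (hcd : c ≤ d) : L1Bound f d :=
  fun s => (h s).trans hcd

/-- `A² Δ` has norm at most `2 / h`. -/
lemma opBound_movAvg_sq_mul {B : (ℤ → ℝ) → ℝ → Prop} (hB : IsShiftNorm B) {h : ℕ} (hh : 0 < h) :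
    OpBound B (movAvg h ^ 2 * (Polynomial.X - 1)) (2 / h) := by
  have h0 : (0 : ℝ) < h := by exact_mod_cast hh
  rw [pow_two, mul_assoc, movAvg_mul_X_sub_one]
  have := (opBound_movAvg hB hh).mul ((OpBound.X_pow_sub_one hB h).smul hB (h : ℝ)⁻¹)
  have e : (1 : ℝ) * (|(h : ℝ)⁻¹| * 2) = 2 / h := by
    rw [abs_of_pos (inv_pos.2 h0)]; field_simp
  rwa [e] at this

/-- `A² Δ` maps `ℓ¹` to `ℓ^∞` with norm at most `2 / h²`. -/
lemma supBound_movAvg_sq_mul {h : ℕ} (hh : 0 < h) {f : ℤ → ℝ} {c : ℝ} (hf : L1Bound f c) :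
    SupBound (shiftAct (movAvg h ^ 2 * (Polynomial.X - 1)) f) (2 * c / h ^ 2) := by
  have h0 : (0 : ℝ) < h := by exact_mod_cast hh
  rw [pow_two, mul_assoc, movAvg_mul_X_sub_one, shiftAct_mul_apply]
  have hg := (OpBound.X_pow_sub_one isShiftNorm_l1Bound h).smul isShiftNorm_l1Bound (h : ℝ)⁻¹ f c hf
  set g := shiftAct ((h : ℝ)⁻¹ • (Polynomial.X ^ h - 1)) f
  rw [abs_of_pos (inv_pos.2 h0)] at hg
  intro j
  have e : shiftAct (movAvg h) g j = (h : ℝ)⁻¹ * ∑ i ∈ Finset.range h, g (j + i) := by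
    simp [shiftAct, movAvg, LinearMap.sum_apply, Finset.sum_apply, shiftEnd_pow_apply]
  have hs : |∑ i ∈ Finset.range h, g (j + i)| ≤ (h : ℝ)⁻¹ * 2 * c := by
    refine (Finset.abs_sum_le_sum_abs _ _).trans ?_
    have := hg ((Finset.range h).map ⟨fun i : ℕ => j + (i : ℤ), fun a b hab => by simpa using hab⟩)
    rw [Finset.sum_map] at this
    exact this
  rw [e, abs_mul, abs_of_pos (inv_pos.2 h0)]
  calc (h : ℝ)⁻¹ * |∑ i ∈ Finset.range h, g (j + i)| ≤ (h : ℝ)⁻¹ * ((h : ℝ)⁻¹ * 2 * c) := by gcongr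
    _ = 2 * c / h ^ 2 := by field_simp

/-! ### Smoothness of laws on the integers -/

/-- The convolution `a ↦ ∫ G (a - x) dμ(x)` of a bounded function with a law on the integers. -/
def intConv (μ : Measure ℤ) (G : ℤ → ℝ) (a : ℤ) : ℝ := ∫ x, G (a - x) ∂μ

/-- The convolution with `μ`, followed by the polynomial `p` in the shift, has norm at most `K`
on bounded functions. For `p = (X - 1) ^ n` this says that the `n`-th difference of the point
probabilities of `μ` has `ℓ¹` norm at most `K`. -/
def SmoothBy (μ : Measure ℤ) (p : Polynomial ℝ) (K : ℝ) : Prop :=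
  ∀ G c, SupBound G c → SupBound (intConv μ (shiftAct p G)) (K * c)

lemma shiftAct_apply (p : Polynomial ℝ) (f : ℤ → ℝ) (j : ℤ) :
    shiftAct p f j = ∑ i ∈ Finset.range (p.natDegree + 1), p.coeff i * f (j + i) := by
  rw [shiftAct, Polynomial.aeval_eq_sum_range]
  simp [LinearMap.sum_apply, Finset.sum_apply, shiftEnd_pow_apply]

lemma integrable_of_supBound (μ : Measure ℤ) [IsFiniteMeasure μ] {G : ℤ → ℝ} {c : ℝ}
    (hG : SupBound G c) (a : ℤ) : Integrable (fun x => G (a - x)) μ :=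
  Integrable.of_bound (by fun_prop) c (ae_of_all _ fun x => hG _)

lemma supBound_intConv (μ : Measure ℤ) [IsProbabilityMeasure μ] {G : ℤ → ℝ} {c : ℝ}
    (hG : SupBound G c) : SupBound (intConv μ G) c := by
  intro a
  have h : ∀ x, ‖G (a - x)‖ ≤ c := fun x => hG (a - x)
  simpa [intConv] using norm_integral_le_of_norm_le_const (μ := μ) (ae_of_all _ h)

lemma intConv_shiftAct (μ : Measure ℤ) [IsFiniteMeasure μ] (p : Polynomial ℝ) {G : ℤ → ℝ} {c : ℝ}
    (hG : SupBound G c) : intConv μ (shiftAct p G) = shiftAct p (intConv μ G) := by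
  ext a
  simp only [intConv, shiftAct_apply]
  rw [integral_finsetSum]
  · refine Finset.sum_congr rfl fun i _ => ?_
    rw [integral_const_mul]
    simp only [add_sub_right_comm]
  · intro i _
    have := (integrable_of_supBound μ hG (a + i)).const_mul (p.coeff i)
    simpa only [add_sub_right_comm] using this

lemma exists_supBound_shiftAct (p : Polynomial ℝ) {G : ℤ → ℝ} {c : ℝ} (hG : SupBound G c) :
    ∃ d, SupBound (shiftAct p G) d := by
  refine ⟨∑ i ∈ Finset.range (p.natDegree + 1), |p.coeff i| * c, fun j => ?_⟩
  rw [shiftAct_apply]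
  refine (Finset.abs_sum_le_sum_abs _ _).trans (Finset.sum_le_sum fun i _ => ?_)
  rw [abs_mul]
  exact mul_le_mul_of_nonneg_left (hG _) (abs_nonneg _)

lemma intConv_conv (μ ν : Measure ℤ) [IsFiniteMeasure μ] [IsFiniteMeasure ν] {G : ℤ → ℝ} {c : ℝ}
    (hG : SupBound G c) : intConv (μ ∗ ν) G = intConv μ (intConv ν G) := by
  ext a
  simp only [intConv]
  rw [integral_conv (integrable_of_supBound _ hG a)]
  simp_rw [sub_sub]

lemma intConv_conv' (μ ν : Measure ℤ) [IsFiniteMeasure μ] [IsFiniteMeasure ν] {G : ℤ → ℝ} {c : ℝ}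
    (hG : SupBound G c) : intConv (μ ∗ ν) G = intConv ν (intConv μ G) := by
  rw [Measure.conv_comm, intConv_conv _ _ hG]

namespace SmoothBy

variable {μ ν : Measure ℤ}

lemma mono {p : Polynomial ℝ} {K L : ℝ} (h : SmoothBy μ p K) (hKL : K ≤ L) : SmoothBy μ p L :=
  fun G c hG => (h G c hG).mono (mul_le_mul_of_nonneg_right hKL hG.nonneg)

lemma one (μ : Measure ℤ) [IsProbabilityMeasure μ] : SmoothBy μ 1 1 := by
  intro G c hG
  simpa [shiftAct] using supBound_intConv μ hG

lemma conv [IsFiniteMeasure μ] [IsFiniteMeasure ν] {p q : Polynomial ℝ} {K L : ℝ}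
    (hμ : SmoothBy μ p K) (hν : SmoothBy ν q L) : SmoothBy (μ ∗ ν) (p * q) (K * L) := by
  intro G c hG
  have hpq := exists_supBound_shiftAct q hG
  obtain ⟨d, hd⟩ := hpq
  obtain ⟨d', hd'⟩ := exists_supBound_shiftAct p hd
  rw [shiftAct_mul_apply, intConv_conv _ _ hd', intConv_shiftAct ν p hd, mul_assoc]
  exact hμ _ _ (hν _ _ hG)

lemma conv_right [IsFiniteMeasure μ] [IsProbabilityMeasure ν] {p : Polynomial ℝ} {K : ℝ}
    (hμ : SmoothBy μ p K) : SmoothBy (μ ∗ ν) p K := by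
  simpa using hμ.conv (SmoothBy.one ν)

lemma mul_opBound {p q : Polynomial ℝ} {K t : ℝ} (hμ : SmoothBy μ p K)
    (hq : OpBound SupBound q t) : SmoothBy μ (p * q) (K * t) := by
  intro G c hG
  rw [shiftAct_mul_apply, mul_assoc]
  exact hμ _ _ (hq _ _ hG)

end SmoothBy

/-! ### The symmetric random walk -/

lemma sum_choose_mul_sq (n : ℕ) :
    ∑ i ∈ Finset.range (n + 1), (n.choose i : ℝ) * (2 * (i : ℝ) - n) ^ 2 = (n : ℝ) * 2 ^ n := by
  have h := congrArg (Polynomial.eval (1 / 2 : ℝ)) (bernsteinPolynomial.variance ℝ n)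
  simp only [Polynomial.eval_finsetSum, Polynomial.eval_mul, Polynomial.eval_pow,
    Polynomial.eval_sub, Polynomial.eval_X, bernsteinPolynomial, Polynomial.eval_natCast,
    nsmul_eq_mul, Polynomial.eval_one] at h
  have h2 : ∑ i ∈ Finset.range (n + 1), (n.choose i : ℝ) * (2 * (i : ℝ) - n) ^ 2 =
      4 * 2 ^ n * ∑ x ∈ Finset.range (n + 1), ((n : ℝ) * (1 / 2) - x) ^ 2 *
        (n.choose x * (1 / 2) ^ x * (1 - 1 / 2) ^ (n - x)) := by
    rw [Finset.mul_sum]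
    refine Finset.sum_congr rfl fun i hi => ?_
    have hi' : i ≤ n := by simpa [Nat.lt_succ_iff] using hi
    have e : (1 / 2 : ℝ) ^ i * (1 - 1 / 2) ^ (n - i) = (1 / 2) ^ n := by
      rw [show (1 - 1 / 2 : ℝ) = 1 / 2 by norm_num, ← pow_add, Nat.add_sub_cancel' hi']
    have e2 : (2 : ℝ) ^ n * (1 / 2) ^ n = 1 := by rw [← mul_pow]; norm_num
    rw [mul_assoc (n.choose i : ℝ), e]
    calc (n.choose i : ℝ) * (2 * i - n) ^ 2 = (n.choose i : ℝ) * (2 * i - n) ^ 2 * (2 ^ n * (1 / 2) ^ n) := by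
          rw [e2, mul_one]
      _ = _ := by ring
  rw [h2, h]; ring

lemma sum_choose_mul_abs_le (n : ℕ) :
    ∑ i ∈ Finset.range (n + 1), (n.choose i : ℝ) * |2 * (i : ℝ) - n| ≤ √n * 2 ^ n := by
  refine abs_le_of_sq_le_sq' ?_ (by positivity) |>.2
  have hcs := Finset.sum_mul_sq_le_sq_mul_sq (Finset.range (n + 1))
    (fun i => √(n.choose i : ℝ)) (fun i => √(n.choose i : ℝ) * |2 * (i : ℝ) - n|)
  have e1 : ∀ i, √(n.choose i : ℝ) * (√(n.choose i : ℝ) * |2 * (i : ℝ) - n|) =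
      (n.choose i : ℝ) * |2 * (i : ℝ) - n| := fun i => by
    rw [← mul_assoc, Real.mul_self_sqrt (by positivity)]
  have e2 : ∀ i, √(n.choose i : ℝ) ^ 2 = n.choose i := fun i => Real.sq_sqrt (by positivity)
  simp only [e1, mul_pow, e2, sq_abs, sum_choose_mul_sq] at hcs
  have e3 : ∑ i ∈ Finset.range (n + 1), (n.choose i : ℝ) = 2 ^ n := by
    exact_mod_cast Nat.sum_range_choose n
  rw [e3] at hcs
  rw [mul_pow, Real.sq_sqrt (by positivity)]
  linarith

/-- The polynomial in the shift that averages a function over a point and its successor. -/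
def halfStep : Polynomial ℝ := (1 / 2 : ℝ) • (1 + Polynomial.X)

/-- The coefficients come from the identity
`2 X ((1 + X)^(j+1))' - (j+1) (1 + X)^(j+1) = (j+1) (X - 1) (1 + X)^j`,
so that the `ℓ¹` norm of the polynomial is a mean absolute deviation of a binomial law. -/
lemma X_sub_one_mul_halfStep_pow (j : ℕ) :
    (Polynomial.X - 1) * halfStep ^ j = ∑ i ∈ Finset.range (j + 2),
      ((1 / 2 : ℝ) ^ j * (1 / (j + 1)) * ((j + 1).choose i * (2 * i - (j + 1)))) •
        (Polynomial.X ^ i : Polynomial ℝ) := by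
  have hb : ((1 : Polynomial ℝ) + Polynomial.X) ^ (j + 1) =
      ∑ i ∈ Finset.range (j + 2), ((j + 1).choose i : ℝ) • (Polynomial.X ^ i : Polynomial ℝ) := by
    rw [add_comm, add_pow]
    refine Finset.sum_congr rfl fun i _ => ?_
    rw [one_pow, mul_one, mul_comm, Polynomial.smul_eq_C_mul]; simp
  have hd := congrArg (fun p => Polynomial.X * Polynomial.derivative p) hb
  simp only [Polynomial.derivative_pow_succ, Polynomial.derivative_add, Polynomial.derivative_one,
    Polynomial.derivative_X, zero_add, mul_one, Polynomial.derivative_sum,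
    Polynomial.derivative_smul, Finset.mul_sum] at hd
  have hd2 : ∀ i : ℕ, (Polynomial.X : Polynomial ℝ) * ((j + 1).choose i : ℝ) •
      Polynomial.derivative ((Polynomial.X : Polynomial ℝ) ^ i) =
      (((j + 1).choose i : ℝ) * i) • (Polynomial.X ^ i : Polynomial ℝ) := by
    intro i
    rw [Polynomial.derivative_X_pow]
    rcases i with _ | i
    · simp
    · simp only [Polynomial.smul_eq_C_mul, Polynomial.C_mul, Nat.add_sub_cancel]; ring
  simp only [hd2] at hd
  have hj : ((j : ℝ) + 1) ≠ 0 := by positivity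
  have hC : (Polynomial.C (1 / ((j : ℝ) + 1))) * (Polynomial.C ((j : ℝ) + 1)) = 1 := by
    rw [← Polynomial.C_mul, one_div, inv_mul_cancel₀ hj, Polynomial.C_1]
  have hsum : ∑ i ∈ Finset.range (j + 2),
      ((1 / 2 : ℝ) ^ j * (1 / (j + 1)) * ((j + 1).choose i * (2 * i - (j + 1)))) •
        (Polynomial.X ^ i : Polynomial ℝ) =
      Polynomial.C ((1 / 2 : ℝ) ^ j * (1 / (j + 1))) *
       (2 * ∑ i ∈ Finset.range (j + 2), (((j + 1).choose i : ℝ) * i) • (Polynomial.X ^ i : Polynomial ℝ)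
        - Polynomial.C ((j : ℝ) + 1) * ∑ i ∈ Finset.range (j + 2),
          ((j + 1).choose i : ℝ) • (Polynomial.X ^ i : Polynomial ℝ)) := by
    rw [Finset.mul_sum, Finset.mul_sum, ← Finset.sum_sub_distrib, Finset.mul_sum]
    refine Finset.sum_congr rfl fun i _ => ?_
    simp only [Polynomial.smul_eq_C_mul, Polynomial.C_mul, Polynomial.C_sub, Polynomial.C_ofNat]
    ring
  rw [hsum, ← hd, ← hb, halfStep, Polynomial.smul_eq_C_mul, mul_pow, ← Polynomial.C_pow,
    Polynomial.C_mul, pow_succ]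
  have e : (Polynomial.C ((j : ℝ) + 1)) = Polynomial.C (j : ℝ) + 1 := by simp
  rw [e] at hC ⊢
  linear_combination (-(Polynomial.X - 1) * Polynomial.C ((1 / 2 : ℝ) ^ j) * (1 + Polynomial.X) ^ j) * hC

lemma opBound_X_sub_one_mul_halfStep_pow {B : (ℤ → ℝ) → ℝ → Prop} (hB : IsShiftNorm B)
    (hmono : ∀ {f c d}, B f c → c ≤ d → B f d) (hnn : ∀ {f c}, B f c → 0 ≤ c) (j : ℕ) :
    OpBound B ((Polynomial.X - 1) * halfStep ^ j) (2 * √(1 / (j + 1))) := by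
  rw [X_sub_one_mul_halfStep_pow]
  intro f c hf
  refine hmono (OpBound.sum hB _ (fun i _ => (OpBound.X_pow hB i).smul hB _) f c hf)
    (mul_le_mul_of_nonneg_right ?_ (hnn hf))
  have h := sum_choose_mul_abs_le (j + 1)
  push_cast at h
  have e : ∀ i : ℕ, |(1 / 2 : ℝ) ^ j * (1 / (j + 1)) * ((j + 1).choose i * (2 * i - (j + 1)))| * 1 =
      (1 / 2 : ℝ) ^ j * (1 / (j + 1)) * ((j + 1).choose i * |2 * (i : ℝ) - (j + 1)|) := by
    intro i
    rw [mul_one, abs_mul, abs_mul ((j + 1).choose i : ℝ), abs_of_nonneg (by positivity),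
      abs_of_nonneg (by positivity : (0 : ℝ) ≤ (j + 1).choose i)]
  simp only [e]
  rw [← Finset.mul_sum]
  have hj : (0 : ℝ) < j + 1 := by positivity
  calc (1 / 2 : ℝ) ^ j * (1 / (j + 1)) * ∑ i ∈ Finset.range (j + 2),
        ((j + 1).choose i * |2 * (i : ℝ) - (j + 1)|)
      ≤ (1 / 2 : ℝ) ^ j * (1 / (j + 1)) * (√(j + 1) * 2 ^ (j + 1)) := by gcongr
    _ = 2 * ((1 / 2) ^ j * 2 ^ j) * (√(j + 1) / (j + 1)) := by ring
    _ = 2 * √(1 / (j + 1)) := by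
      rw [← mul_pow, Real.sqrt_div_self', Real.sqrt_div zero_le_one]; norm_num

/-! ### Sums of independent variables whose laws overlap with their translates -/

lemma intCdf_succ (ρ : Measure ℤ) [IsFiniteMeasure ρ] (j : ℤ) :
    fwdDiff 1 (intCdf ρ) j = ρ.real {j + 1} := by
  have : Set.Iic (j + 1) = Set.Iic j ∪ {j + 1} := by
    ext x; simp; omega
  rw [fwdDiff, intCdf, intCdf, this, measureReal_union (by simp) (by simp)]
  ring

lemma summable_measureReal_singleton (ρ : Measure ℤ) [IsFiniteMeasure ρ] :
    Summable fun x : ℤ => ρ.real {x} := by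
  refine ENNReal.summable_toReal ?_
  have h := lintegral_countable' (μ := ρ) fun _ => 1
  simp only [lintegral_const, one_mul] at h
  rw [← h]
  exact measure_ne_top _ _

lemma tsum_measureReal_singleton (ρ : Measure ℤ) [IsProbabilityMeasure ρ] :
    ∑' x : ℤ, ρ.real {x} = 1 := by
  have := integral_countable (μ := ρ) (integrable_const (1 : ℝ))
  simpa using this.symm

/-- A summable weight `p` on the integers and its translate by one share the mass
`∑' x, min (p x) (p (x + 1))`. -/
lemma tsum_min_translate {p : ℤ → ℝ} (hp : Summable p) (hp0 : ∀ x, 0 ≤ p x)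
    (hp1 : ∑' x, p x = 1) :
    ∑' x, min (p x) (p (x + 1)) = 1 - 1 / 2 * ∑' x, |p (x + 1) - p x| := by
  have hps : Summable fun x => p (x + 1) := (Equiv.addRight (1 : ℤ)).summable_iff.2 hp
  have hps1 : ∑' x, p (x + 1) = 1 := by
    rw [← hp1]; exact (Equiv.addRight (1 : ℤ)).tsum_eq p
  have hm : Summable fun x => min (p x) (p (x + 1)) :=
    hp.of_nonneg_of_le (fun x => le_min (hp0 _) (hp0 _)) fun x => min_le_left _ _
  have e2 : ∀ x, |p (x + 1) - p x| = p (x + 1) + p x - 2 * min (p x) (p (x + 1)) := fun x => by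
    rcases le_total (p x) (p (x + 1)) with h | h
    · rw [min_eq_left h, abs_of_nonneg (by linarith)]; ring
    · rw [min_eq_right h, abs_of_nonpos (by linarith)]; ring
  rw [tsum_congr e2, (hps.add hp).tsum_sub (hm.mul_left 2), hps.tsum_add hp, tsum_mul_left,
    hp1, hps1]
  ring

/-- With `m x = min (p x) (p (x + 1))`, the weight `p` is the sum of `(m x + m (x - 1)) / 2` and of
a nonnegative remainder; the first part averages `H` over neighbouring points. -/
lemma abs_tsum_mul_le_of_overlap {p : ℤ → ℝ} (hp : Summable p) (hp0 : ∀ x, 0 ≤ p x)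
    (hp1 : ∑' x, p x = 1) {u : ℝ} (hu : u ≤ ∑' x, min (p x) (p (x + 1))) {H : ℤ → ℝ} {b₀ b₁ : ℝ}
    (h₀ : ∀ y, |H y| ≤ b₀) (h₁ : ∀ y, |(H y + H (y + 1)) / 2| ≤ b₁) (hb : b₁ ≤ b₀) (a : ℤ) :
    |∑' x, p x * H (a - x)| ≤ u * b₁ + (1 - u) * b₀ := by
  obtain ⟨m, hmdef⟩ : ∃ m : ℤ → ℝ, m = fun x => min (p x) (p (x + 1)) := ⟨_, rfl⟩
  rw [← hmdef] at hu
  have hm0 : ∀ x, 0 ≤ m x := fun x => by rw [hmdef]; exact le_min (hp0 _) (hp0 _)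
  have hmle : ∀ x, m x ≤ p x := fun x => by rw [hmdef]; exact min_le_left _ _
  have hmle' : ∀ x, m (x - 1) ≤ p x := fun x => by
    rw [hmdef]; simp only [sub_add_cancel]; exact min_le_right _ _
  have hm : Summable m := hp.of_nonneg_of_le hm0 hmle
  have hms : Summable fun x => m (x - 1) := (Equiv.subRight (1 : ℤ)).summable_iff.2 hm
  have hms1 : ∑' x, m (x - 1) = ∑' x, m x := (Equiv.subRight (1 : ℤ)).tsum_eq m
  obtain ⟨s, hsdef⟩ : ∃ s : ℤ → ℝ, ∀ x, s x = p x - (m x + m (x - 1)) / 2 := ⟨_, fun _ => rfl⟩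
  have hs0 : ∀ x, 0 ≤ s x := fun x => by
    rw [hsdef]; linarith [hmle x, hmle' x]
  have hs : Summable s := by
    rw [show s = _ from funext hsdef]; exact hp.sub ((hm.add hms).div_const 2)
  have hs1 : ∑' x, s x = 1 - ∑' x, m x := by
    rw [tsum_congr hsdef, hp.tsum_sub ((hm.add hms).div_const 2), tsum_div_const, hm.tsum_add hms,
      hms1, hp1]
    ring
  have hbd : ∀ (w : ℤ → ℝ) (y : ℤ → ℤ), Summable w → (∀ x, 0 ≤ w x) →
      Summable fun x => w x * H (y x) := fun w y hw hw0 =>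
    Summable.of_norm_bounded (hw.mul_right b₀) fun x => by
      rw [norm_mul, Real.norm_of_nonneg (hw0 x)]
      exact mul_le_mul_of_nonneg_left (h₀ _) (hw0 x)
  have i1 := hbd m (fun x => a - x) hm hm0
  have i2 := hbd m (fun x => a - x - 1) hm hm0
  have i3 := hbd (fun x => m (x - 1)) (fun x => a - x) hms fun x => hm0 _
  have i4 := hbd s (fun x => a - x) hs hs0
  have e3 : ∑' x, m x * H (a - x - 1) = ∑' x, m (x - 1) * H (a - x) := by
    rw [← (Equiv.subRight (1 : ℤ)).tsum_eq (fun x => m x * H (a - x - 1))]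
    refine tsum_congr fun x => ?_
    simp only [Equiv.subRight_apply]
    rw [sub_sub, sub_add_cancel]
  have e4 : ∀ x, m x * ((H (a - x - 1) + H (a - x - 1 + 1)) / 2) =
      (m x * H (a - x - 1) + m x * H (a - x)) / 2 := fun x => by
    rw [sub_add_cancel]; ring
  have key : ∑' x, p x * H (a - x) =
      ∑' x, m x * ((H (a - x - 1) + H (a - x - 1 + 1)) / 2) + ∑' x, s x * H (a - x) := by
    rw [tsum_congr e4, tsum_div_const, i2.tsum_add i1, e3, ← i3.tsum_add i1, ← tsum_div_const,
      ← ((i3.add i1).div_const 2).tsum_add i4]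
    refine tsum_congr fun x => ?_
    rw [hsdef]
    ring
  have n1 : |∑' x, m x * ((H (a - x - 1) + H (a - x - 1 + 1)) / 2)| ≤ (∑' x, m x) * b₁ := by
    rw [← tsum_mul_right, ← Real.norm_eq_abs]
    refine tsum_of_norm_bounded (hm.mul_right b₁).hasSum fun x => ?_
    rw [norm_mul, Real.norm_of_nonneg (hm0 x)]
    exact mul_le_mul_of_nonneg_left (h₁ _) (hm0 x)
  have n2 : |∑' x, s x * H (a - x)| ≤ (∑' x, s x) * b₀ := by
    rw [← tsum_mul_right, ← Real.norm_eq_abs]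
    refine tsum_of_norm_bounded (hs.mul_right b₀).hasSum fun x => ?_
    rw [norm_mul, Real.norm_of_nonneg (hs0 x)]
    exact mul_le_mul_of_nonneg_left (h₀ _) (hs0 x)
  rw [key]
  refine (abs_add_le _ _).trans ((add_le_add n1 n2).trans ?_)
  rw [hs1]
  nlinarith [mul_nonneg (sub_nonneg.2 hu) (sub_nonneg.2 hb)]

lemma smoothD_one_eq (ρ : Measure ℤ) [IsFiniteMeasure ρ] :
    smoothD 1 ρ = ∑' x, |ρ.real {x + 1} - ρ.real {x}| := by
  rw [smoothD, l1Norm, ← (Equiv.addRight (1 : ℤ)).tsum_eq (fun x => |ρ.real {x + 1} - ρ.real {x}|)]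
  refine tsum_congr fun j => ?_
  rw [Function.iterate_succ_apply', Function.iterate_one, fwdDiff, intCdf_succ, intCdf_succ]
  rfl

/-- If `ρ` and its translate by one share mass `u`, then convolution with `ρ` contains
`halfStep` with weight `u`. -/
lemma supBound_intConv_of_overlap (ρ : Measure ℤ) [IsProbabilityMeasure ρ] {u : ℝ}
    (hu : u ≤ 1 - 1 / 2 * smoothD 1 ρ) {H : ℤ → ℝ} {b₀ b₁ : ℝ} (h₀ : SupBound H b₀)
    (h₁ : SupBound (shiftAct halfStep H) b₁) (hb : b₁ ≤ b₀) :
    SupBound (intConv ρ H) (u * b₁ + (1 - u) * b₀) := by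
  intro a
  have eh : ∀ y, shiftAct halfStep H y = (H y + H (y + 1)) / 2 := fun y => by
    simp [shiftAct, halfStep, shiftEnd_apply]; ring
  rw [smoothD_one_eq, ← tsum_min_translate (summable_measureReal_singleton ρ)
    (fun _ => measureReal_nonneg) (tsum_measureReal_singleton ρ)] at hu
  rw [intConv, integral_countable (integrable_of_supBound ρ h₀ a)]
  exact abs_tsum_mul_le_of_overlap (summable_measureReal_singleton ρ)
    (fun _ => measureReal_nonneg) (tsum_measureReal_singleton ρ) hu h₀
    (fun y => by rw [← eh]; exact h₁ y) hb a

/-- The inductive step for the bounds `√(1 / (i + 1 + j u / 2))`, with `y = i + 1 + j u / 2`: one more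
summand raises the exponent `i` of `halfStep` by one with weight `u`. -/
lemma mix_inv_sqrt_le {u y : ℝ} (hu0 : 0 ≤ u) (hu1 : u ≤ 1) (hy : 1 ≤ y) :
    u * √(1 / (y + 1)) + (1 - u) * √(1 / y) ≤ √(1 / (y + u / 2)) := by
  apply Real.le_sqrt_of_sq_le
  have h1 : √(1 / (y + 1)) ^ 2 = 1 / (y + 1) := Real.sq_sqrt (by positivity)
  have h2 : √(1 / y) ^ 2 = 1 / y := Real.sq_sqrt (by positivity)
  have hconv : (u * √(1 / (y + 1)) + (1 - u) * √(1 / y)) ^ 2 ≤ u * (1 / (y + 1)) + (1 - u) * (1 / y) := by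
    nlinarith [mul_nonneg (mul_nonneg hu0 (sub_nonneg.2 hu1)) (sq_nonneg (√(1 / (y + 1)) - √(1 / y))),
      h1, h2]
  refine hconv.trans ?_
  have hy0 : 0 < y := by linarith
  have e : u * (1 / (y + 1)) + (1 - u) * (1 / y) = (y + 1 - u) / (y * (y + 1)) := by
    field_simp; ring
  rw [e, div_le_div_iff₀ (by positivity) (by positivity)]
  nlinarith [mul_nonneg hu0 (sub_nonneg.2 hy), mul_nonneg hu0 hu0]

/-- One block of summands gains one difference: if the law `L 0` gains `K` from `(X - 1) ^ n`, and
`m` summands with overlap `u` are added, one further difference gains a factor of order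
`(u m)^(-1/2)`. The exponent `i` of `halfStep` carries the induction. -/
lemma smoothBy_block {L ρ : ℕ → Measure ℤ} [∀ j, IsProbabilityMeasure (L j)]
    [∀ j, IsProbabilityMeasure (ρ j)] {m : ℕ} {u : ℝ} (hu0 : 0 ≤ u) (hu1 : u ≤ 1)
    (hL : ∀ j < m, L (j + 1) = L j ∗ ρ j) (hρ : ∀ j < m, u ≤ 1 - 1 / 2 * smoothD 1 (ρ j))
    {n : ℕ} {K : ℝ} (hK : 0 ≤ K) (h0 : SmoothBy (L 0) ((Polynomial.X - 1) ^ n) K) (i : ℕ) :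
    SmoothBy (L m) ((Polynomial.X - 1) ^ (n + 1) * halfStep ^ i)
      (K * (2 * √(1 / (i + 1 + m * (u / 2))))) := by
  suffices H : ∀ j ≤ m, ∀ i : ℕ, SmoothBy (L j) ((Polynomial.X - 1) ^ (n + 1) * halfStep ^ i)
      (K * (2 * √(1 / (i + 1 + j * (u / 2))))) from H m le_rfl i
  intro j
  induction j with
  | zero =>
    intro _ i
    have := h0.mul_opBound (opBound_X_sub_one_mul_halfStep_pow isShiftNorm_supBound
      SupBound.mono SupBound.nonneg i)
    rw [← mul_assoc, ← pow_succ] at this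
    simpa using this
  | succ j ih =>
    intro hj i
    have hj' : j < m := hj
    intro G c hG
    obtain ⟨d, hd⟩ := exists_supBound_shiftAct ((Polynomial.X - 1) ^ (n + 1) * halfStep ^ i) hG
    rw [hL j hj', intConv_conv' _ _ hd]
    have g0 := ih hj'.le i G c hG
    have g1 := ih hj'.le (i + 1) G c hG
    have e : (Polynomial.X - 1) ^ (n + 1) * halfStep ^ (i + 1) =
        halfStep * ((Polynomial.X - 1) ^ (n + 1) * halfStep ^ i) := by ring
    rw [e, shiftAct_mul_apply, intConv_shiftAct _ _ hd] at g1
    set y : ℝ := i + 1 + j * (u / 2)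
    have hy : 1 ≤ y := by
      have : 0 ≤ (i : ℝ) + j * (u / 2) := by positivity
      simp only [y]; linarith
    have ey : ((i + 1 : ℕ) : ℝ) + 1 + j * (u / 2) = y + 1 := by simp only [y]; push_cast; ring
    rw [ey] at g1
    have hmon : √(1 / (y + 1)) ≤ √(1 / y) := by gcongr; linarith
    have hc := hG.nonneg
    have := supBound_intConv_of_overlap (ρ j) (hρ j hj') g0 g1 (by gcongr)
    refine this.mono ?_
    have hmix := mix_inv_sqrt_le hu0 hu1 hy
    have ey2 : (i : ℝ) + 1 + ((j + 1 : ℕ) : ℝ) * (u / 2) = y + u / 2 := by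
      simp only [y]; push_cast; ring
    rw [ey2]
    calc u * (K * (2 * √(1 / (y + 1))) * c) + (1 - u) * (K * (2 * √(1 / y)) * c)
        = K * (2 * (u * √(1 / (y + 1)) + (1 - u) * √(1 / y))) * c := by ring
      _ ≤ K * (2 * √(1 / (y + u / 2))) * c := by gcongr

/-- The law of `Y + ∑_{j < M} Z_j` with independent summands, cut into `n` blocks. -/
lemma smoothBy_sum {L ρ : ℕ → Measure ℤ} [∀ j, IsProbabilityMeasure (L j)]
    [∀ j, IsProbabilityMeasure (ρ j)] {M : ℕ} {u : ℝ} (hu0 : 0 < u) (hu1 : u ≤ 1)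
    (hL : ∀ j < M, L (j + 1) = L j ∗ ρ j) (hρ : ∀ j < M, u ≤ 1 - 1 / 2 * smoothD 1 (ρ j))
    {n : ℕ} (hn : 0 < n) {t : ℝ} (ht : 0 < t) (htM : t ≤ M) :
    SmoothBy (L M) ((Polynomial.X - 1) ^ n) (√(8 * n / (u * t)) ^ n) := by
  set m := M / n
  have hnm : n * m ≤ M := Nat.mul_div_le M n
  set b : ℝ := 2 * √(1 / (1 + m * (u / 2)))
  have hblocks : ∀ k ≤ n, SmoothBy (L (k * m)) ((Polynomial.X - 1) ^ k) (b ^ k) := by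
    intro k
    induction k with
    | zero => intro _; simpa using SmoothBy.one (L 0)
    | succ k ih =>
      intro hk
      have hkm : (k + 1) * m ≤ M := (Nat.mul_le_mul_right m hk).trans hnm
      have := smoothBy_block (L := fun j => L (k * m + j)) (ρ := fun j => ρ (k * m + j)) (m := m)
        hu0.le hu1 (fun j hj => hL (k * m + j) (by rw [add_mul, one_mul] at hkm; omega))
        (fun j hj => hρ (k * m + j) (by rw [add_mul, one_mul] at hkm; omega)) (n := k) (K := b ^ k)
        (by positivity) (by simpa using ih (by omega)) 0
      have e : k * m + m = (k + 1) * m := by ring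
      simp only [e] at this
      simpa [pow_succ, b] using this
  -- the remaining `M - n m` summands do no harm
  have hrest : ∀ j, n * m + j ≤ M → SmoothBy (L (n * m + j)) ((Polynomial.X - 1) ^ n) (b ^ n) := by
    intro j
    induction j with
    | zero => intro _; exact hblocks n le_rfl
    | succ j ih =>
      intro hj
      rw [← add_assoc, hL _ (by omega)]
      exact (ih (by omega)).conv_right
  have hfin := hrest (M - n * m) (by omega)
  rw [Nat.add_sub_cancel' hnm] at hfin
  refine hfin.mono (pow_le_pow_left₀ (by positivity) ?_ n)
  have hm : (M : ℝ) ≤ n * (m + 1) := by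
    have : M < n * (m + 1) := by
      have := Nat.lt_mul_div_succ M hn
      simpa using this
    exact_mod_cast this.le
  have hn' : (0 : ℝ) < n := by exact_mod_cast hn
  have e4 : b = √(4 / (1 + m * (u / 2))) := by
    rw [show (4 : ℝ) / (1 + m * (u / 2)) = 2 ^ 2 * (1 / (1 + m * (u / 2))) by ring,
      Real.sqrt_mul (by positivity), Real.sqrt_sq (by norm_num)]
  rw [e4]
  apply Real.sqrt_le_sqrt
  rw [div_le_div_iff₀ (by positivity) (by positivity)]
  nlinarith [mul_le_mul_of_nonneg_left (htM.trans hm) hu0.le, mul_nonneg hn'.le (sub_nonneg.2 hu1)]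

/-! ### Differences of distribution functions -/

lemma intCdf_eq_intConv (μ : Measure ℤ) :
    intCdf μ = intConv μ (Set.indicator (Set.Ici 0) 1) := by
  ext a
  have : (fun x : ℤ => Set.indicator (Set.Ici (0 : ℤ)) (1 : ℤ → ℝ) (a - x)) =
      Set.indicator (Set.Iic a) 1 := by
    ext x; simp [Set.indicator_apply]
  rw [intConv, this, integral_indicator_one (by measurability), intCdf]

lemma SmoothBy.supBound_intCdf {μ : Measure ℤ} [IsFiniteMeasure μ] {n : ℕ} {K : ℝ}
    (h : SmoothBy μ ((Polynomial.X - 1) ^ n) K) : SupBound ((fwdDiff (1 : ℤ))^[n] (intCdf μ)) K := by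
  have hG : SupBound (Set.indicator (Set.Ici (0 : ℤ)) (1 : ℤ → ℝ)) 1 := fun j => by
    by_cases hj : j ∈ Set.Ici (0 : ℤ) <;> simp [hj]
  have := h _ _ hG
  rwa [intConv_shiftAct _ _ hG, ← intCdf_eq_intConv, shiftAct_X_sub_one_pow, mul_one] at this

/-- The `ℓ¹` norm is tested against a sign pattern supported on a finite set. -/
lemma SmoothBy.l1Bound_intCdf {μ : Measure ℤ} [IsFiniteMeasure μ] {n : ℕ} {K : ℝ}
    (h : SmoothBy μ ((Polynomial.X - 1) ^ n) K) :
    L1Bound ((fwdDiff (1 : ℤ))^[n + 1] (intCdf μ)) K := by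
  intro s
  rw [Function.iterate_succ_apply]
  set D : ℤ → ℝ := (fwdDiff (1 : ℤ))^[n] (fwdDiff 1 (intCdf μ)) with hD
  rw [← shiftAct_X_sub_one_pow] at hD
  set ε : ℤ → ℝ := fun j => SignType.sign (D j)
  have hε : ∀ j, |ε j| ≤ 1 := fun j => by
    simp only [ε]; cases SignType.sign (D j) <;> simp
  set G : ℤ → ℝ := fun y => ∑ j ∈ s, ε j * (if y = -j - 1 then 1 else 0) with hGdef
  have hG : SupBound G 1 := by
    intro y
    have : G y = ∑ j ∈ s, if -y - 1 = j then ε j else 0 := by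
      refine Finset.sum_congr rfl fun j _ => ?_
      rw [mul_ite, mul_one, mul_zero]
      exact if_congr (by constructor <;> intro h <;> omega) rfl rfl
    rw [this, Finset.sum_ite_eq]
    split_ifs
    · exact hε _
    · simp
  have hconv : ∀ a, intConv μ G a = ∑ j ∈ s, ε j * fwdDiff 1 (intCdf μ) (a + j) := by
    intro a
    have e : ∀ (j x : ℤ), (if a - x = -j - 1 then (1 : ℝ) else 0) =
        Set.indicator {a + j + 1} 1 x := fun j x => by
      rw [Set.indicator_apply]
      exact if_congr (by simp only [Set.mem_singleton_iff]; constructor <;> intro h <;> omega) rfl rfl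
    simp only [intConv, hGdef, e]
    rw [integral_finsetSum]
    · refine Finset.sum_congr rfl fun j _ => ?_
      rw [integral_const_mul, integral_indicator_one (by measurability), intCdf_succ]
    · intro j _
      exact ((integrable_const (1 : ℝ)).indicator (by measurability)).const_mul _
  have h0 := h G 1 hG 0
  rw [intConv_shiftAct _ _ hG, mul_one] at h0
  have key : ∑ j ∈ s, |D j| = shiftAct ((Polynomial.X - 1) ^ n) (intConv μ G) 0 := by
    rw [shiftAct_apply]
    simp only [hconv, Finset.mul_sum]
    rw [Finset.sum_comm]
    refine Finset.sum_congr rfl fun j _ => ?_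
    have : |D j| = ε j * D j := (sign_mul_self (D j)).symm
    rw [this]
    conv_lhs => rw [hD, shiftAct_apply]
    rw [Finset.mul_sum]
    refine Finset.sum_congr rfl fun i _ => ?_
    rw [show (0 : ℤ) + i + j = j + i by ring]
    ring
  rw [key]
  exact (le_abs_self _).trans h0

/-! ### The conditional law -/

/-- The partial sum `y + z_0 + ⋯ + z_{j-1}` of a point `(y, (z_j)_j)`. -/
def partialSum (j : ℕ) (p : ℤ × (ℕ → ℤ)) : ℤ := p.1 + ∑ i ∈ Finset.range j, p.2 i

lemma measurable_partialSum (j : ℕ) : Measurable (partialSum j) := by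
  unfold partialSum; fun_prop

lemma map_partialSum_succ {κ : Measure (ℤ × (ℕ → ℤ))} [IsProbabilityMeasure κ] {M : ℕ}
    (hκ : iIndepFun (blockCoord M) κ) {j : ℕ} (hj : j < M) :
    κ.map (partialSum (j + 1)) = κ.map (partialSum j) ∗ κ.map (fun p => p.2 j) := by
  classical
  have hmeas : ∀ i, Measurable (blockCoord M i) := by
    rintro (_ | i)
    · exact measurable_fst
    · exact (measurable_pi_apply _).comp measurable_snd
  set s : Finset (Option (Fin M)) :=
    insert none ((Finset.univ.filter fun i : Fin M => (i : ℕ) < j).map Function.Embedding.some)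
  have hns : some (⟨j, hj⟩ : Fin M) ∉ s := by simp [s]
  have hind := hκ.indepFun_finsetSum_of_notMem hmeas hns
  have e1 : ∑ i ∈ s, blockCoord M i = partialSum j := by
    ext p
    simp only [s]
    rw [Finset.sum_insert (by simp), Finset.sum_map]
    simp only [Pi.add_apply, Finset.sum_apply, partialSum, blockCoord, Function.Embedding.some_apply]
    congr 1
    refine Finset.sum_bij (fun i _ => (i : ℕ)) ?_ ?_ ?_ ?_
    · intro i hi; simpa using hi
    · intro a _ b _ h; exact Fin.ext h
    · intro b hb
      have hb' : b < j := by simpa using hb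
      exact ⟨⟨b, hb'.trans hj⟩, by simpa using hb', rfl⟩
    · intro i _; rfl
  rw [e1] at hind
  have e2 : partialSum (j + 1) = partialSum j + fun p => p.2 j := by
    ext p
    simp only [partialSum, Pi.add_apply, Finset.sum_range_succ]
    ring
  rw [e2]
  exact hind.map_add_eq_map_conv_map (measurable_partialSum j)
    ((measurable_pi_apply _).comp measurable_snd)

section

variable {Ω β S : Type*} [MeasurableSpace Ω] [mβ : MeasurableSpace β] [MeasurableSpace S]
  [StandardBorelSpace S] [Nonempty S] {P : Measure Ω} [IsProbabilityMeasure P] {X : Ω → β} {V : Ω → S}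

lemma integral_comp_prodMk_eq_condDistrib (hX : Measurable X) (hV : Measurable V)
    {F : β × S → ℝ} (hF : Measurable F) {c : ℝ} (hFb : ∀ q, ‖F q‖ ≤ c) :
    ∫ ω, F (X ω, V ω) ∂P = ∫ ω, ∫ x, F (X ω, x) ∂(condDistrib V X P (X ω)) ∂P := by
  have hpair : Measurable fun ω => (X ω, V ω) := hX.prodMk hV
  have hprob : IsProbabilityMeasure (P.map fun ω => (X ω, V ω)) :=
    Measure.isProbabilityMeasure_map hpair.aemeasurable
  have hint : Integrable F (P.map fun ω => (X ω, V ω)) :=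
    Integrable.of_bound hF.aestronglyMeasurable c (ae_of_all _ hFb)
  have e := compProd_map_condDistrib (mβ := mβ) (X := X) (μ := P) hV.aemeasurable
  rw [← integral_map hpair.aemeasurable hF.aestronglyMeasurable, ← e]
  rw [← e] at hint
  rw [Measure.integral_compProd hint, integral_map hX.aemeasurable]
  exact (hF.stronglyMeasurable.integral_condDistrib).aestronglyMeasurable

lemma ae_condDistrib_comp {S' : Type*} [MeasurableSpace S'] [StandardBorelSpace S'] [Nonempty S']
    (hX : Measurable X) (hV : Measurable V) {f : S → S'} (hf : Measurable f) :
    ∀ᵐ ω ∂P, condDistrib (fun ω => f (V ω)) X P (X ω) = (condDistrib V X P (X ω)).map f := by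
  filter_upwards [ae_of_ae_map hX.aemeasurable (condDistrib_comp X hV.aemeasurable hf)] with ω hω
  rw [Kernel.map_apply _ hf] at hω
  exact hω

end

/-- Disintegration of the law of the random partial sum on an event that is known given `𝓕`. -/
lemma setIntegral_partialSum {Ω : Type*} (𝓕 : MeasurableSpace Ω) [mΩ : MeasurableSpace Ω]
    (h𝓕 : 𝓕 ≤ mΩ) (P : Measure Ω) [IsProbabilityMeasure P] {N : Ω → ℕ} (hN : Measurable[𝓕] N)
    {V : Ω → ℤ × (ℕ → ℤ)} (hV : Measurable V) (T : Set ℕ) {G : ℤ → ℝ} {c : ℝ}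
    (hG : SupBound G c) :
    ∫ ω in N ⁻¹' T, G (partialSum (N ω) (V ω)) ∂P =
      ∫ ω in N ⁻¹' T, ∫ x, G (partialSum (N ω) x) ∂(condLaw 𝓕 P V ω) ∂P := by
  have hid : @Measurable Ω Ω mΩ 𝓕 id := measurable_id'' h𝓕
  set F : Ω × (ℤ × (ℕ → ℤ)) → ℝ := fun q =>
    (T.indicator 1 (N q.1) : ℝ) * G (partialSum (N q.1) q.2)
  have hps : Measurable fun q : ℕ × (ℤ × (ℕ → ℤ)) => partialSum q.1 q.2 :=
    measurable_from_prod_countable_right fun j => measurable_partialSum j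
  have hN1 : @Measurable _ _ (𝓕.prod inferInstance) _ fun q : Ω × (ℤ × (ℕ → ℤ)) => N q.1 :=
    hN.comp measurable_fst
  have hF : @Measurable _ _ (𝓕.prod inferInstance) _ F := by
    refine Measurable.mul ?_ ?_
    · exact (measurable_of_countable (T.indicator (1 : ℕ → ℝ))).comp hN1
    · exact (measurable_of_countable G).comp (hps.comp (hN1.prodMk measurable_snd))
  have hFb : ∀ q, ‖F q‖ ≤ c := fun q => by
    simp only [F, norm_mul]
    have h1 : ‖(T.indicator 1 (N q.1) : ℝ)‖ ≤ 1 := by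
      by_cases hq : N q.1 ∈ T <;> simp [hq]
    calc _ ≤ 1 * c := mul_le_mul h1 (hG _) (abs_nonneg _) zero_le_one
      _ = c := one_mul c
  have hT : @MeasurableSet Ω mΩ (N ⁻¹' T) := h𝓕 _ (hN (by measurability))
  have h1 : ∫ ω, F (id ω, V ω) ∂P = ∫ ω, ∫ x, F (ω, x) ∂(condLaw 𝓕 P V ω) ∂P :=
    integral_comp_prodMk_eq_condDistrib (mβ := 𝓕) hid hV hF hFb
  rw [← integral_indicator hT, ← integral_indicator hT]
  convert h1 using 2
  · ext ω
    by_cases hω : N ω ∈ T <;> simp [F, hω]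
  · ext ω
    by_cases hω : N ω ∈ T <;> simp [F, hω]

/-- The part of the law of `W` on the event that `N ≥ t` inherits the smoothness of the conditional
laws. -/
lemma smoothBy_map_restrict {Ω : Type*} (𝓕 : MeasurableSpace Ω) [mΩ : MeasurableSpace Ω]
    (h𝓕 : 𝓕 ≤ mΩ) (P : Measure Ω) [IsProbabilityMeasure P] {W : Ω → ℤ} (hW : Measurable W)
    {N : Ω → ℕ} (hN : Measurable[𝓕] N) {Y : Ω → ℤ} (hY : Measurable Y)
    {Z : ℕ → Ω → ℤ} (hZ : ∀ j, Measurable (Z j))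
    (hdecomp : ∀ᵐ ω ∂P, W ω = Y ω + ∑ j ∈ Finset.range (N ω), Z j ω)
    (hindep : ∀ᵐ ω ∂P, iIndepFun (blockCoord (N ω))
      (condLaw 𝓕 P (fun ω' => (Y ω', fun j => Z j ω')) ω))
    {u t : ℝ} (hu0 : 0 < u) (hu1 : u ≤ 1) (ht : 0 < t)
    (hsmooth : ∀ᵐ ω ∂P, ∀ j < N ω, u ≤ 1 - 1 / 2 * smoothD 1 (condLaw 𝓕 P (Z j) ω))
    {n : ℕ} (hn : 0 < n) :
    SmoothBy ((P.restrict {ω | t ≤ N ω}).map W) ((Polynomial.X - 1) ^ n)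
      (√(8 * n / (u * t)) ^ n) := by
  set V : Ω → ℤ × (ℕ → ℤ) := fun ω => (Y ω, fun j => Z j ω)
  have hV : Measurable V := hY.prodMk (measurable_pi_lambda _ hZ)
  have hid : @Measurable Ω Ω mΩ 𝓕 id := measurable_id'' h𝓕
  have hcoord : ∀ j, ∀ᵐ ω ∂P, condLaw 𝓕 P (Z j) ω = (condLaw 𝓕 P V ω).map (fun p => p.2 j) := by
    intro j
    have hf : Measurable fun p : ℤ × (ℕ → ℤ) => p.2 j :=
      (measurable_pi_apply _).comp measurable_snd
    exact ae_condDistrib_comp (mβ := 𝓕) (X := (id : Ω → Ω)) hid hV hf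
  have hcoord' := ae_all_iff.2 hcoord
  intro G c hG a
  obtain ⟨d, hd⟩ := exists_supBound_shiftAct ((Polynomial.X - 1) ^ n) hG
  set G' : ℤ → ℝ := shiftAct ((Polynomial.X - 1) ^ n) G
  have hset : {ω | t ≤ N ω} = N ⁻¹' {k | t ≤ k} := rfl
  have hT : @MeasurableSet Ω mΩ {ω | t ≤ N ω} := h𝓕 _ (hN (t := {k : ℕ | t ≤ k}) (by measurability))
  have e1 : intConv ((P.restrict {ω | t ≤ N ω}).map W) G' a =
      ∫ ω in N ⁻¹' {k | t ≤ k}, ∫ x, G' (a - partialSum (N ω) x) ∂(condLaw 𝓕 P V ω) ∂P := by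
    rw [intConv, integral_map hW.aemeasurable (by fun_prop),
      ← setIntegral_partialSum 𝓕 h𝓕 P hN hV _ (G := fun y => G' (a - y)) (c := d) (fun y => hd _)]
    refine integral_congr_ae (ae_restrict_of_ae ?_)
    filter_upwards [hdecomp] with ω hω
    simp only [hω]; rfl
  rw [e1]
  have hK : 0 ≤ √(8 * n / (u * t)) ^ n * c := mul_nonneg (by positivity) hG.nonneg
  have hb : ∀ᵐ ω ∂(P.restrict {ω | t ≤ N ω}),
      ‖∫ x, G' (a - partialSum (N ω) x) ∂(condLaw 𝓕 P V ω)‖ ≤ √(8 * n / (u * t)) ^ n * c := by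
    rw [ae_restrict_iff' hT]
    filter_upwards [hindep, hsmooth, hcoord'] with ω h1 h2 h3 h4
    have : IsProbabilityMeasure (condLaw 𝓕 P V ω) := by unfold condLaw; infer_instance
    have hp1 : ∀ j, IsProbabilityMeasure ((condLaw 𝓕 P V ω).map (partialSum j)) := fun j =>
      Measure.isProbabilityMeasure_map (measurable_partialSum j).aemeasurable
    have hp2 : ∀ j, IsProbabilityMeasure ((condLaw 𝓕 P V ω).map fun p => p.2 j) := fun j =>
      Measure.isProbabilityMeasure_map
        ((measurable_pi_apply _).comp measurable_snd).aemeasurable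
    have := smoothBy_sum (L := fun j => (condLaw 𝓕 P V ω).map (partialSum j))
      (ρ := fun j => (condLaw 𝓕 P V ω).map fun p => p.2 j) (M := N ω) hu0 hu1
      (fun j hj => map_partialSum_succ h1 hj) (fun j hj => by rw [← h3 j]; exact h2 j hj) hn ht h4
      G c hG a
    rw [intConv, integral_map (measurable_partialSum _).aemeasurable (by fun_prop)] at this
    exact this
  refine (norm_integral_le_of_norm_le_const hb).trans ?_
  refine mul_le_of_le_one_right hK ?_
  rw [measureReal_restrict_apply_univ]
  exact measureReal_le_one

/-! ### The Poisson law -/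

section Poisson

open scoped NNReal Nat

/-- The Stein–Chen identity; if one side is not integrable, neither is the other. -/
lemma integral_nat_mul_poisson (r : ℝ≥0) (g : ℕ → ℝ) :
    ∫ n, (n : ℝ) * g n ∂(poissonMeasure r) = r * ∫ n, g (n + 1) ∂(poissonMeasure r) := by
  rw [integral_poissonMeasure, integral_poissonMeasure, ← tsum_mul_left]
  set f : ℕ → ℝ := fun n => (Real.exp (-r) * (r : ℝ) ^ n / (n)!) • ((n : ℝ) * g n)
  have e : ∀ n, f (n + 1) = r * (Real.exp (-r) * (r : ℝ) ^ n / (n)!) • g (n + 1) := by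
    intro n
    simp only [f, smul_eq_mul, Nat.factorial_succ]
    push_cast
    field_simp
    ring
  by_cases hs : Summable fun n => f (n + 1)
  · rw [tsum_eq_zero_add' hs]
    simp only [e]
    simp [f]
  · have hs' : ¬ Summable f := fun h => hs ((summable_nat_add_iff 1).2 h)
    rw [tsum_eq_zero_of_not_summable hs']
    simp only [e] at hs
    rw [tsum_eq_zero_of_not_summable hs]

lemma integrable_nat_mul_poisson (r : ℝ≥0) {g : ℕ → ℝ}
    (hg : Integrable (fun n => g (n + 1)) (poissonMeasure r)) :
    Integrable (fun n : ℕ => (n : ℝ) * g n) (poissonMeasure r) := by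
  rw [integrable_poissonMeasure_iff] at hg ⊢
  rw [← summable_nat_add_iff 1]
  refine (hg.mul_left (r : ℝ)).congr fun n => ?_
  simp only [Nat.factorial_succ, norm_mul, RCLike.norm_natCast]
  push_cast
  field_simp
  ring

lemma integrable_poisson_id (r : ℝ≥0) : Integrable (fun n : ℕ => (n : ℝ)) (poissonMeasure r) := by
  simpa using integrable_nat_mul_poisson r (g := fun _ => 1) (integrable_const _)

lemma integral_poisson_id (r : ℝ≥0) : ∫ n : ℕ, (n : ℝ) ∂(poissonMeasure r) = r := by
  simpa using integral_nat_mul_poisson r fun _ => 1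

lemma integrable_poisson_sq (r : ℝ≥0) :
    Integrable (fun n : ℕ => (n : ℝ) ^ 2) (poissonMeasure r) := by
  have := integrable_nat_mul_poisson r (g := fun n => (n : ℝ))
    (by simpa using (integrable_poisson_id r).add (integrable_const (1 : ℝ)))
  simpa [pow_two] using this

lemma integral_poisson_sq (r : ℝ≥0) :
    ∫ n : ℕ, (n : ℝ) ^ 2 ∂(poissonMeasure r) = r ^ 2 + r := by
  have := integral_nat_mul_poisson r fun n => (n : ℝ)
  push_cast at this
  rw [integral_add (integrable_poisson_id r) (integrable_const _), integral_poisson_id] at this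
  simp only [pow_two, this]
  simp; ring

lemma integrable_poisson_sub_sq (r : ℝ≥0) :
    Integrable (fun n : ℕ => ((n : ℝ) - r) ^ 2) (poissonMeasure r) := by
  have := ((integrable_poisson_sq r).sub ((integrable_poisson_id r).const_mul (2 * (r : ℝ)))).add
    (integrable_const ((r : ℝ) ^ 2))
  refine this.congr (ae_of_all _ fun n => ?_)
  simp; ring

lemma integral_poisson_sub_sq (r : ℝ≥0) :
    ∫ n : ℕ, ((n : ℝ) - r) ^ 2 ∂(poissonMeasure r) = r := by
  have e : ∀ n : ℕ, ((n : ℝ) - r) ^ 2 = (n : ℝ) ^ 2 - 2 * r * n + (r : ℝ) ^ 2 := fun n => by ring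
  have i1 : Integrable (fun n : ℕ => (n : ℝ) ^ 2 - 2 * r * n) (poissonMeasure r) :=
    (integrable_poisson_sq r).sub ((integrable_poisson_id r).const_mul _)
  simp only [e]
  rw [integral_add i1 (integrable_const _), integral_sub (integrable_poisson_sq r)
    ((integrable_poisson_id r).const_mul _), integral_const_mul, integral_poisson_id,
    integral_poisson_sq]
  simp; ring

lemma abs_le_sq_div_add {x s : ℝ} (hs : 0 < s) : |x| ≤ 1 / (2 * s) * x ^ 2 + s / 2 := by
  have h1 : 1 / (2 * s) * x ^ 2 + s / 2 - |x| = (|x| - s) ^ 2 / (2 * s) := by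
    rw [← sq_abs x]; field_simp; ring
  have h2 : 0 ≤ (|x| - s) ^ 2 / (2 * s) := by positivity
  linarith

lemma integral_poisson_abs_sub_le {r : ℝ≥0} (hr : 0 < r) :
    ∫ n : ℕ, |(n : ℝ) - r| ∂(poissonMeasure r) ≤ √(r : ℝ) := by
  have hs : 0 < √(r : ℝ) := Real.sqrt_pos.2 (NNReal.coe_pos.2 hr)
  have i1 : Integrable (fun n : ℕ => (1 / (2 * √(r : ℝ))) * ((n : ℝ) - r) ^ 2) (poissonMeasure r) :=
    (integrable_poisson_sub_sq r).const_mul _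
  have i2 : Integrable (fun n : ℕ => |(n : ℝ) - r|) (poissonMeasure r) :=
    ((integrable_poisson_id r).sub (integrable_const _)).abs
  have i3 : Integrable (fun n : ℕ => (1 / (2 * √(r : ℝ))) * ((n : ℝ) - r) ^ 2 + √(r : ℝ) / 2)
      (poissonMeasure r) := i1.add (integrable_const _)
  have h := integral_mono i2 i3 fun n => abs_le_sq_div_add hs
  rw [integral_add i1 (integrable_const _), integral_const_mul, integral_poisson_sub_sq,
    integral_const, probReal_univ, one_smul] at h
  refine h.trans (le_of_eq ?_)
  have e : 1 / (2 * √(r : ℝ)) * r = √(r : ℝ) / 2 := by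
    rw [div_mul_eq_mul_div, one_mul, div_eq_div_iff (by positivity) two_ne_zero]
    nlinarith [Real.mul_self_sqrt (NNReal.coe_nonneg r)]
  rw [e]; ring

/-- By the Stein–Chen identity,
`E (G (a + 1 - X) - G (a - X)) = E ((1 - X / r) G (a + 1 - X))`. -/
lemma smoothBy_poisson {r : ℝ≥0} (hr : 0 < r) :
    SmoothBy ((poissonMeasure r).map ((↑) : ℕ → ℤ)) (Polynomial.X - 1) (1 / √r) := by
  intro G c hG a
  have hr' : (0 : ℝ) < r := by exact_mod_cast hr
  have hb : ∀ b : ℤ, Integrable (fun n : ℕ => G (b - n)) (poissonMeasure r) := fun b =>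
    Integrable.of_bound (by fun_prop) c (ae_of_all _ fun x => hG _)
  have hst := integral_nat_mul_poisson r fun n => G (a + 1 - n)
  have hsi := integrable_nat_mul_poisson r (g := fun n => G (a + 1 - n))
    (by simpa using hb a)
  have e1 : intConv ((poissonMeasure r).map ((↑) : ℕ → ℤ)) (shiftAct (Polynomial.X - 1) G) a =
      ∫ n : ℕ, (-1 / (r : ℝ)) * (((n : ℝ) - r) * G (a + 1 - n)) ∂(poissonMeasure r) := by
    rw [intConv, integral_map (by fun_prop) (by fun_prop), shiftAct_X_sub_one]
    have e2 : ∀ n : ℕ, (-1 / (r : ℝ)) * (((n : ℝ) - r) * G (a + 1 - n)) =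
        (-1 / (r : ℝ)) * ((n : ℝ) * G (a + 1 - n)) + G (a + 1 - n) := fun n => by
      field_simp; ring
    simp only [e2, fwdDiff]
    rw [integral_add (hsi.const_mul _) (hb _), integral_const_mul, hst]
    have e3 : ∀ n : ℕ, a + 1 - ((n + 1 : ℕ) : ℤ) = a - n := fun n => by push_cast; ring
    have e4 : ∀ n : ℕ, a - (n : ℤ) + 1 = a + 1 - n := fun n => by ring
    simp only [e3, e4]
    rw [integral_sub (hb _) (hb _)]
    field_simp; ring
  rw [e1, integral_const_mul, abs_mul]
  have hbd : |∫ n : ℕ, ((n : ℝ) - r) * G (a + 1 - n) ∂(poissonMeasure r)| ≤ √r * c := by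
    rw [← Real.norm_eq_abs]
    refine (norm_integral_le_integral_norm _).trans ?_
    calc ∫ n : ℕ, ‖((n : ℝ) - r) * G (a + 1 - n)‖ ∂(poissonMeasure r)
        ≤ ∫ n : ℕ, |(n : ℝ) - r| * c ∂(poissonMeasure r) := by
          refine integral_mono_of_nonneg (ae_of_all _ fun _ => norm_nonneg _)
            (((integrable_poisson_id r).sub (integrable_const _)).abs.mul_const c)
            (ae_of_all _ fun n => ?_)
          change ‖((n : ℝ) - r) * G (a + 1 - n)‖ ≤ _
          rw [norm_mul]
          exact mul_le_mul_of_nonneg_left (hG _) (abs_nonneg _)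
      _ ≤ √r * c := by
        rw [integral_mul_const]
        exact mul_le_mul_of_nonneg_right (integral_poisson_abs_sub_le hr) hG.nonneg
  have e5 : |(-1 / (r : ℝ))| = 1 / r := by rw [abs_div, abs_neg, abs_one, abs_of_pos hr']
  rw [e5]
  calc 1 / (r : ℝ) * _ ≤ 1 / r * (√r * c) := by gcongr
    _ = (√r / r) * c := by ring
    _ = 1 / √r * c := by rw [Real.sqrt_div_self']

/-- The Poisson law of parameter `r` is the `n`-fold convolution of the one of parameter `r / n`. -/
lemma smoothBy_poisson_pow {r : ℝ≥0} (hr : 0 < r) {n : ℕ} (hn : 0 < n) :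
    SmoothBy ((poissonMeasure r).map ((↑) : ℕ → ℤ)) ((Polynomial.X - 1) ^ n) (√(n / r) ^ n) := by
  have key : ∀ (q : ℝ≥0), 0 < q → ∀ k : ℕ, SmoothBy ((poissonMeasure (k * q)).map ((↑) : ℕ → ℤ))
      ((Polynomial.X - 1) ^ k) ((1 / √q) ^ k) := by
    intro q hq k
    induction k with
    | zero =>
      have : IsProbabilityMeasure ((poissonMeasure (((0 : ℕ) : ℝ≥0) * q)).map ((↑) : ℕ → ℤ)) :=
        Measure.isProbabilityMeasure_map .of_discrete
      simpa using SmoothBy.one ((poissonMeasure (((0 : ℕ) : ℝ≥0) * q)).map ((↑) : ℕ → ℤ))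
    | succ k ih =>
      have e : ((k + 1 : ℕ) : ℝ≥0) * q = k * q + q := by push_cast; ring
      rw [e, ← map_cast_poissonMeasure_conv, pow_succ, pow_succ]
      exact ih.conv (smoothBy_poisson hq)
  have hn' : (0 : ℝ≥0) < n := by exact_mod_cast hn
  have := key (r / n) (by positivity) n
  rw [mul_div_cancel₀ _ hn'.ne'] at this
  have e : 1 / √((r / n : ℝ≥0) : ℝ) = √(n / r) := by
    push_cast
    rw [one_div, ← Real.sqrt_inv, inv_div]
  rwa [e] at this

lemma SmoothBy.map_add_const {μ : Measure ℤ} {p : Polynomial ℝ} {K : ℝ} (h : SmoothBy μ p K)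
    (m : ℤ) : SmoothBy (μ.map (· + m)) p K := by
  intro G c hG a
  rw [intConv, integral_map (by fun_prop) (by fun_prop)]
  have := h G c hG (a - m)
  rw [intConv] at this
  have e : ∀ x : ℤ, a - (x + m) = a - m - x := fun x => by ring
  simpa only [e] using this

lemma smoothBy_translatedPoisson (a : ℝ) {s : ℝ} (hs : 0 < s) {n : ℕ} (hn : 0 < n) :
    SmoothBy (translatedPoisson a s) ((Polynomial.X - 1) ^ n) (√(n / s) ^ n) := by
  have hf := Int.fract_nonneg (a - s)
  have hr : 0 < (s + Int.fract (a - s)).toNNReal := Real.toNNReal_pos.2 (by linarith)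
  have h := (smoothBy_poisson_pow hr hn).map_add_const ⌊a - s⌋
  rw [Measure.map_map (by fun_prop) (by fun_prop)] at h
  refine SmoothBy.mono h ?_
  rw [Real.coe_toNNReal _ (by linarith)]
  gcongr
  linarith

end Poisson

/-! ### Stein's equation for the normal law -/

/-- The unnormalised standard normal density. -/
def gaussWeight (t : ℝ) : ℝ := Real.exp (-(1 / 2) * t ^ 2)

lemma gaussWeight_pos (t : ℝ) : 0 < gaussWeight t := Real.exp_pos _

lemma gaussWeight_neg (t : ℝ) : gaussWeight (-t) = gaussWeight t := by simp [gaussWeight]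

lemma continuous_gaussWeight : Continuous gaussWeight := by unfold gaussWeight; fun_prop

lemma integrable_gaussWeight : Integrable gaussWeight :=
  integrable_exp_neg_mul_sq (by norm_num : (0 : ℝ) < 1 / 2)

lemma integrable_mul_gaussWeight : Integrable fun t => t * gaussWeight t :=
  integrable_mul_exp_neg_mul_sq (by norm_num : (0 : ℝ) < 1 / 2)

lemma hasDerivAt_gaussWeight (t : ℝ) : HasDerivAt gaussWeight (-(t * gaussWeight t)) t := by
  have h : HasDerivAt (fun t : ℝ => -(1 / 2) * t ^ 2) (-t) t := by
    refine ((hasDerivAt_pow 2 t).const_mul (-(1 / 2) : ℝ)).congr_deriv ?_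
    norm_num
    ring
  refine h.exp.congr_deriv ?_
  simp only [gaussWeight]; ring

lemma integral_gaussWeight_le : ∫ t, gaussWeight t ≤ 3 := by
  have h : ∫ t, gaussWeight t = √(Real.pi / (1 / 2)) := integral_gaussian (1 / 2)
  rw [h, Real.sqrt_le_left (by norm_num)]
  have := Real.pi_lt_d2
  norm_num; linarith

lemma tendsto_gaussWeight_atBot : Tendsto gaussWeight atBot (nhds 0) := by
  refine Real.tendsto_exp_atBot.comp ?_
  have h : Tendsto (fun t : ℝ => t ^ 2) atBot atTop := by
    have := (tendsto_pow_atTop (α := ℝ) two_ne_zero).comp tendsto_neg_atBot_atTop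
    simpa [Function.comp_def] using this
  exact h.const_mul_atTop_of_neg (by norm_num)

lemma setIntegral_Iic_abs_mul_gaussWeight {w : ℝ} (hw : w ≤ 0) :
    ∫ t in Set.Iic w, |t| * gaussWeight t = gaussWeight w := by
  have h : ∫ t in Set.Iic w, -(t * gaussWeight t) = gaussWeight w - 0 :=
    integral_Iic_of_hasDerivAt_of_tendsto continuous_gaussWeight.continuousWithinAt
      (fun t _ => hasDerivAt_gaussWeight t) integrable_mul_gaussWeight.neg.integrableOn
      tendsto_gaussWeight_atBot
  rw [sub_zero] at h
  rw [← h]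
  refine setIntegral_congr_fun measurableSet_Iic fun t ht => ?_
  rw [abs_of_nonpos (le_trans ht hw)]; ring

lemma setIntegral_Iic_gaussWeight_le {w : ℝ} (hw : w ≤ 0) :
    ∫ t in Set.Iic w, gaussWeight t ≤ 3 * gaussWeight w := by
  have hle : ∀ t ∈ Set.Iic w, gaussWeight t ≤ gaussWeight w * gaussWeight (t - w) := by
    intro t ht
    rw [gaussWeight, gaussWeight, gaussWeight, ← Real.exp_add]
    apply Real.exp_le_exp.2
    have ht' : t ≤ w := ht
    nlinarith [mul_nonneg (neg_nonneg.2 hw) (sub_nonneg.2 ht')]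
  have hi : Integrable fun t => gaussWeight w * gaussWeight (t - w) :=
    (integrable_gaussWeight.comp_sub_right w).const_mul _
  calc ∫ t in Set.Iic w, gaussWeight t
      ≤ ∫ t in Set.Iic w, gaussWeight w * gaussWeight (t - w) :=
        setIntegral_mono_on integrable_gaussWeight.integrableOn hi.integrableOn measurableSet_Iic hle
    _ ≤ ∫ t, gaussWeight w * gaussWeight (t - w) :=
        setIntegral_le_integral hi (ae_of_all _ fun t =>
          mul_nonneg (gaussWeight_pos _).le (gaussWeight_pos _).le)
    _ = gaussWeight w * ∫ t, gaussWeight t := by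
        rw [integral_const_mul, integral_sub_right_eq_self gaussWeight w]
    _ ≤ 3 * gaussWeight w := by
        rw [mul_comm]
        exact mul_le_mul_of_nonneg_right integral_gaussWeight_le (gaussWeight_pos _).le

lemma integrable_mul_gaussWeight_of_le {g : ℝ → ℝ} (hg : Measurable g) (hgb : ∀ t, |g t| ≤ |t| + 3) :
    Integrable fun t => g t * gaussWeight t := by
  have h1 : Integrable fun t => (|t| + 3) * gaussWeight t := by
    have := integrable_mul_gaussWeight.norm.add (integrable_gaussWeight.const_mul 3)
    refine this.congr (ae_of_all _ fun t => ?_)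
    simp [abs_of_pos (gaussWeight_pos t), add_mul]
  refine h1.mono' (hg.mul continuous_gaussWeight.measurable).aestronglyMeasurable
    (ae_of_all _ fun t => ?_)
  rw [norm_mul, Real.norm_of_nonneg (gaussWeight_pos t).le]
  exact mul_le_mul_of_nonneg_right (hgb t) (gaussWeight_pos t).le

lemma abs_setIntegral_Iic_le {g : ℝ → ℝ} (hg : Measurable g) (hgb : ∀ t, |g t| ≤ |t| + 3) {w : ℝ}
    (hw : w ≤ 0) : |∫ t in Set.Iic w, g t * gaussWeight t| ≤ 10 * gaussWeight w := by
  have i1 : IntegrableOn (fun t => |t| * gaussWeight t) (Set.Iic w) := by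
    refine (integrable_mul_gaussWeight.norm.congr (ae_of_all _ fun t => ?_)).integrableOn
    simp [abs_of_pos (gaussWeight_pos t)]
  have i2 : IntegrableOn (fun t => 3 * gaussWeight t) (Set.Iic w) :=
    (integrable_gaussWeight.const_mul 3).integrableOn
  calc |∫ t in Set.Iic w, g t * gaussWeight t|
      ≤ ∫ t in Set.Iic w, |g t * gaussWeight t| := abs_integral_le_integral_abs
    _ ≤ ∫ t in Set.Iic w, (|t| * gaussWeight t + 3 * gaussWeight t) := by
        refine integral_mono (integrable_mul_gaussWeight_of_le hg hgb).norm.integrableOn (i1.add i2)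
          fun t => ?_
        change |g t * gaussWeight t| ≤ |t| * gaussWeight t + 3 * gaussWeight t
        rw [abs_mul, abs_of_pos (gaussWeight_pos t), ← add_mul]
        exact mul_le_mul_of_nonneg_right (hgb t) (gaussWeight_pos t).le
    _ ≤ 10 * gaussWeight w := by
        rw [integral_add i1 i2, setIntegral_Iic_abs_mul_gaussWeight hw, integral_const_mul]
        linarith [setIntegral_Iic_gaussWeight_le hw]

/-- The solution `f` of Stein's equation `f' w - w f w = g w`. -/
def steinSol (g : ℝ → ℝ) (w : ℝ) : ℝ :=
  (gaussWeight w)⁻¹ * ∫ t in Set.Iic w, g t * gaussWeight t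

/-- For `w > 0` the integral over `(-∞, w]` is minus the one over `(w, ∞)`. -/
lemma abs_steinSol_le {g : ℝ → ℝ} (hg : Measurable g) (hgb : ∀ t, |g t| ≤ |t| + 3)
    (hg0 : ∫ t, g t * gaussWeight t = 0) (w : ℝ) : |steinSol g w| ≤ 10 := by
  have key : |∫ t in Set.Iic w, g t * gaussWeight t| ≤ 10 * gaussWeight w := by
    rcases le_total w 0 with hw | hw
    · exact abs_setIntegral_Iic_le hg hgb hw
    · have hi := integrable_mul_gaussWeight_of_le hg hgb
      have h1 := intervalIntegral.integral_Iic_add_Ioi (b := w) hi.integrableOn hi.integrableOn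
      rw [hg0] at h1
      have h2 := integral_comp_neg_Iic (-w) fun t => g t * gaussWeight t
      rw [neg_neg] at h2
      simp only [gaussWeight_neg] at h2
      rw [eq_neg_of_add_eq_zero_left h1, abs_neg, ← h2, ← gaussWeight_neg]
      exact abs_setIntegral_Iic_le (hg.comp measurable_neg) (fun t => by simpa using hgb (-t))
        (by linarith)
  rw [steinSol, abs_mul, abs_of_pos (inv_pos.2 (gaussWeight_pos w)), inv_mul_le_iff₀ (gaussWeight_pos w),
    mul_comm]
  exact key

lemma setIntegral_Iic_eq_add {g : ℝ → ℝ} (hg : Measurable g) (hgb : ∀ t, |g t| ≤ |t| + 3) :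
    (fun w => ∫ t in Set.Iic w, g t * gaussWeight t) = fun w =>
      (∫ t in Set.Iic 0, g t * gaussWeight t) + ∫ t in (0 : ℝ)..w, g t * gaussWeight t := by
  have hi := integrable_mul_gaussWeight_of_le hg hgb
  ext w
  rw [← intervalIntegral.integral_Iic_sub_Iic hi.integrableOn hi.integrableOn]; ring

lemma continuous_steinSol {g : ℝ → ℝ} (hg : Measurable g) (hgb : ∀ t, |g t| ≤ |t| + 3) :
    Continuous (steinSol g) := by
  have hi := integrable_mul_gaussWeight_of_le hg hgb
  refine (continuous_gaussWeight.inv₀ fun t => (gaussWeight_pos t).ne').mul ?_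
  rw [setIntegral_Iic_eq_add hg hgb]
  refine continuous_const.add ?_
  exact intervalIntegral.continuous_primitive (fun a b => hi.intervalIntegrable) 0

lemma hasDerivAt_steinSol {g : ℝ → ℝ} (hg : Measurable g) (hgb : ∀ t, |g t| ≤ |t| + 3) {w : ℝ}
    (hw : ContinuousAt g w) : HasDerivAt (steinSol g) (w * steinSol g w + g w) w := by
  have hi := integrable_mul_gaussWeight_of_le hg hgb
  have hd : HasDerivAt (fun w => ∫ t in Set.Iic w, g t * gaussWeight t) (g w * gaussWeight w) w := by
    rw [setIntegral_Iic_eq_add hg hgb]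
    refine HasDerivAt.const_add _ ?_
    exact intervalIntegral.integral_hasDerivAt_right hi.intervalIntegrable
      (hg.mul continuous_gaussWeight.measurable).stronglyMeasurable.stronglyMeasurableAtFilter
      (hw.mul continuous_gaussWeight.continuousAt)
  have hne := (gaussWeight_pos w).ne'
  refine (((hasDerivAt_gaussWeight w).inv hne).mul hd).congr_deriv ?_
  simp only [steinSol, Pi.inv_apply]
  field_simp

lemma intervalIntegrable_stein {g : ℝ → ℝ} (hg : Measurable g) (hgb : ∀ t, |g t| ≤ |t| + 3)
    (a b : ℝ) : IntervalIntegrable (fun t => t * steinSol g t + g t) volume a b := by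
  refine IntervalIntegrable.add
    ((continuous_id.mul (continuous_steinSol hg hgb)).intervalIntegrable a b) ?_
  refine (Continuous.intervalIntegrable (by fun_prop : Continuous fun t : ℝ => |t| + 3) a b).mono_fun'
    hg.aestronglyMeasurable (ae_of_all _ fun t => hgb t)

lemma integral_stein {g : ℝ → ℝ} (hg : Measurable g) (hgb : ∀ t, |g t| ≤ |t| + 3)
    {S : Set ℝ} (hS : S.Countable) (hgS : ∀ t, t ∉ S → ContinuousAt g t) (a b : ℝ) :
    ∫ t in a..b, (t * steinSol g t + g t) = steinSol g b - steinSol g a :=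
  integral_eq_of_hasDerivAt_off_countable _ _ hS (continuous_steinSol hg hgb).continuousOn
    (fun t ht => hasDerivAt_steinSol hg hgb (hgS t ht.2)) (intervalIntegrable_stein hg hgb a b)

lemma abs_steinSol_sub_le {g : ℝ → ℝ} (hg : Measurable g) (hgb : ∀ t, |g t| ≤ |t| + 3)
    (hg0 : ∫ t, g t * gaussWeight t = 0)
    {S : Set ℝ} (hS : S.Countable) (hgS : ∀ t, t ∉ S → ContinuousAt g t) {w t : ℝ}
    (hwt : w ≤ t) (ht : t ≤ w + 1) :
    |steinSol g t - steinSol g w| ≤ (11 * |w| + 14) * (t - w) := by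
  rw [← integral_stein hg hgb hS hgS, ← abs_of_nonneg (sub_nonneg.2 hwt)]
  rw [← Real.norm_eq_abs (∫ r in w..t, _)]
  refine intervalIntegral.norm_integral_le_of_norm_le_const fun r hr => ?_
  rw [Set.uIoc_of_le hwt] at hr
  have hr' : |r| ≤ |w| + 1 := by
    have h1 := neg_abs_le w
    have h2 := le_abs_self w
    rw [abs_le]; constructor <;> linarith [hr.1, hr.2]
  have hf := abs_steinSol_le hg hgb hg0 r
  calc ‖r * steinSol g r + g r‖ ≤ |r| * |steinSol g r| + |g r| := by
        rw [← abs_mul]; exact abs_add_le _ _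
    _ ≤ |r| * 10 + (|r| + 3) := by gcongr; exact hgb r
    _ ≤ 11 * |w| + 14 := by linarith

/-- A difference quotient of step `δ` is close to the value of `f'` given by Stein's equation. -/
lemma abs_diffQuot_sub_stein_le {g : ℝ → ℝ} (hg : Measurable g) (hgb : ∀ t, |g t| ≤ |t| + 3)
    (hg0 : ∫ t, g t * gaussWeight t = 0)
    {S : Set ℝ} (hS : S.Countable) (hgS : ∀ t, t ∉ S → ContinuousAt g t) {w δ o : ℝ}
    (hδ : 0 < δ) (hδ1 : δ ≤ 1) (ho : ∀ t, w ≤ t → t ≤ w + δ → |g t - g w| ≤ o) :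
    |(steinSol g (w + δ) - steinSol g w) / δ - (w * steinSol g w + g w)| ≤
      40 * (1 + w ^ 2) * δ + o := by
  have hle : w ≤ w + δ := by linarith
  have e1 : (steinSol g (w + δ) - steinSol g w) / δ - (w * steinSol g w + g w) =
      (∫ t in w..(w + δ), ((t * steinSol g t + g t) - (w * steinSol g w + g w))) / δ := by
    rw [intervalIntegral.integral_sub (intervalIntegrable_stein hg hgb _ _)
      intervalIntegrable_const, integral_stein hg hgb hS hgS, intervalIntegral.integral_const]
    simp only [smul_eq_mul]
    field_simp
    ring
  rw [e1, abs_div, abs_of_pos hδ, div_le_iff₀ hδ]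
  have hb : ∀ t ∈ Set.uIoc w (w + δ), ‖(t * steinSol g t + g t) - (w * steinSol g w + g w)‖ ≤
      40 * (1 + w ^ 2) * δ + o := by
    intro t ht
    rw [Set.uIoc_of_le hle] at ht
    have ht1 : |t| ≤ |w| + 1 := by
      have h1 := neg_abs_le w
      have h2 := le_abs_self w
      rw [abs_le]; constructor <;> linarith [ht.1, ht.2]
    have htw : t - w ≤ δ := by linarith [ht.2]
    have htw0 : 0 ≤ t - w := by linarith [ht.1]
    have hL := abs_steinSol_sub_le hg hgb hg0 hS hgS ht.1.le (by linarith [ht.2])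
    have hf := abs_steinSol_le hg hgb hg0 w
    have e2 : (t * steinSol g t + g t) - (w * steinSol g w + g w) =
        t * (steinSol g t - steinSol g w) + (t - w) * steinSol g w + (g t - g w) := by ring
    rw [e2]
    calc ‖t * (steinSol g t - steinSol g w) + (t - w) * steinSol g w + (g t - g w)‖
        ≤ |t| * |steinSol g t - steinSol g w| + |t - w| * |steinSol g w| + |g t - g w| := by
          rw [← abs_mul, ← abs_mul]
          exact (abs_add_le _ _).trans (add_le_add_left (abs_add_le _ _) _)
      _ ≤ (|w| + 1) * ((11 * |w| + 14) * δ) + δ * 10 + o := by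
          rw [abs_of_nonneg htw0]
          gcongr
          · exact hL.trans (by gcongr)
          · exact ho t ht.1.le ht.2
      _ ≤ 40 * (1 + w ^ 2) * δ + o := by
          have hq : (|w| + 1) * (11 * |w| + 14) + 10 ≤ 40 * (1 + w ^ 2) := by
            rw [← sq_abs w]; nlinarith [sq_nonneg (|w| - 1)]
          nlinarith [mul_le_mul_of_nonneg_right hq hδ.le]
  have := intervalIntegral.norm_integral_le_of_norm_le_const hb
  rw [add_sub_cancel_left, abs_of_pos hδ] at this
  exact this

/-! ### Normal approximation of the Poisson law -/

lemma integral_sq_gaussian : ∫ x, x ^ 2 ∂(gaussianReal 0 1) = 1 := by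
  have h := variance_fun_id_gaussianReal (μ := 0) (v := 1)
  rw [variance_of_integral_eq_zero (by fun_prop) (by simp)] at h
  simpa using h

lemma integrable_sq_gaussian : Integrable (fun x => x ^ 2) (gaussianReal 0 1) :=
  (memLp_id_gaussianReal (μ := 0) (v := 1) 2).integrable_sq

lemma integrable_id_gaussian : Integrable (fun x : ℝ => x) (gaussianReal 0 1) :=
  (memLp_id_gaussianReal (μ := 0) (v := 1) 1).integrable le_rfl

lemma integral_abs_gaussian_le : ∫ x, |x| ∂(gaussianReal 0 1) ≤ 1 := by
  have i1 : Integrable (fun x : ℝ => 1 / (2 * 1) * x ^ 2) (gaussianReal 0 1) :=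
    integrable_sq_gaussian.const_mul _
  have h := integral_mono (μ := gaussianReal 0 1) integrable_id_gaussian.abs
    (i1.add (integrable_const (1 / 2 : ℝ))) fun x => abs_le_sq_div_add one_pos
  refine h.trans (le_of_eq ?_)
  rw [integral_add' i1 (integrable_const _), integral_const_mul, integral_sq_gaussian]
  simp; norm_num

lemma integral_gaussian_eq (g : ℝ → ℝ) :
    ∫ x, g x ∂(gaussianReal 0 1) = (√(2 * Real.pi))⁻¹ * ∫ t, g t * gaussWeight t := by
  rw [integral_gaussianReal_eq_integral_smul one_ne_zero, ← integral_const_mul]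
  refine integral_congr_ae (ae_of_all _ fun x => ?_)
  simp only [gaussianPDFReal, gaussWeight, smul_eq_mul, NNReal.coe_one, mul_one, sub_zero]
  rw [show -x ^ 2 / 2 = -(1 / 2) * x ^ 2 by ring]; ring

open scoped NNReal in
/-- Stein's method for the Poisson law `X` of parameter `r`, `s² ≤ r ≤ s² + 1`, centred at `r` and
scaled by `s`. By the Stein–Chen identity `E V f(V) = (r / s) E (f (V + 1 / s) - f V)`, so the
error is that of replacing `f'` by a difference quotient; `o` bounds the oscillation of `h`. -/
lemma abs_integral_poisson_sub_gaussian_le {r : ℝ≥0} {s : ℝ} (hs : 1 ≤ s) (hr1 : s ^ 2 ≤ r)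
    (hr2 : (r : ℝ) ≤ s ^ 2 + 1) {h : ℝ → ℝ} (hh : Measurable h) (hhb : ∀ t, |h t| ≤ |t| + 1)
    {S : Set ℝ} (hS : S.Countable) (hhS : ∀ t, t ∉ S → ContinuousAt h t) {o : ℝ → ℝ}
    (ho : ∀ w t, w ≤ t → t ≤ w + 1 / s → |h t - h w| ≤ o w)
    (hoi : Integrable (fun n : ℕ => o (((n : ℝ) - r) / s)) (poissonMeasure r)) :
    |∫ n : ℕ, h (((n : ℝ) - r) / s) ∂(poissonMeasure r) - ∫ x, h x ∂(gaussianReal 0 1)| ≤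
      180 / s + ∫ n : ℕ, o (((n : ℝ) - r) / s) ∂(poissonMeasure r) := by
  have hs0 : 0 < s := by linarith
  set π := poissonMeasure r
  set V : ℕ → ℝ := fun n => ((n : ℝ) - r) / s with hV
  set m := ∫ x, h x ∂(gaussianReal 0 1) with hm
  have hhi : Integrable h (gaussianReal 0 1) :=
    (integrable_id_gaussian.abs.add (integrable_const (1 : ℝ))).mono' hh.aestronglyMeasurable
      (ae_of_all _ hhb)
  have hm2 : |m| ≤ 2 := by
    have h1 := integral_mono (μ := gaussianReal 0 1) hhi.norm
      (integrable_id_gaussian.abs.add (integrable_const (1 : ℝ))) hhb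
    rw [integral_add' integrable_id_gaussian.abs (integrable_const _)] at h1
    simp only [integral_const, probReal_univ, smul_eq_mul, one_mul] at h1
    have h2 := norm_integral_le_integral_norm (μ := gaussianReal 0 1) h
    have h3 : |m| ≤ ∫ x, ‖h x‖ ∂(gaussianReal 0 1) := h2
    linarith [integral_abs_gaussian_le]
  set g : ℝ → ℝ := fun t => h t - m with hgdef
  have hg : Measurable g := hh.sub_const m
  have hgb : ∀ t, |g t| ≤ |t| + 3 := fun t => by
    have := abs_sub (h t) m
    linarith [hhb t]
  have hg0 : ∫ t, g t * gaussWeight t = 0 := by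
    have h1 : ∫ x, g x ∂(gaussianReal 0 1) = 0 := by
      rw [integral_sub hhi (integrable_const _)]; simp [hm]
    rw [integral_gaussian_eq] at h1
    exact (mul_eq_zero.1 h1).resolve_left (by positivity)
  have hgS : ∀ t, t ∉ S → ContinuousAt g t := fun t ht => (hhS t ht).sub continuousAt_const
  set f := steinSol g
  have hfb := abs_steinSol_le hg hgb hg0
  have hfi : ∀ v : ℕ → ℝ, Integrable (fun n => f (v n)) π := fun v =>
    Integrable.of_bound (measurable_of_countable _).aestronglyMeasurable 10 (ae_of_all _ fun n => hfb _)
  have hVi : Integrable V π := ((integrable_poisson_id r).sub (integrable_const _)).div_const s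
  have hV2i : Integrable (fun n => V n ^ 2) π := by
    refine ((integrable_poisson_sub_sq r).div_const (s ^ 2)).congr (ae_of_all _ fun n => ?_)
    simp only [hV, div_pow]
  have hV2 : ∫ n, V n ^ 2 ∂π ≤ 2 := by
    simp only [hV, div_pow]
    rw [integral_div, integral_poisson_sub_sq, div_le_iff₀ (by positivity)]
    nlinarith
  have hgVi : Integrable (fun n => g (V n)) π := by
    refine (hVi.abs.add (integrable_const (3 : ℝ))).mono'
      (measurable_of_countable _).aestronglyMeasurable (ae_of_all _ fun n => ?_)
    exact hgb _
  have hVf : Integrable (fun n => V n * f (V n)) π :=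
    hVi.mul_bdd (c := 10) (measurable_of_countable _).aestronglyMeasurable (ae_of_all _ fun n => hfb _)
  have hnf : Integrable (fun n : ℕ => (n : ℝ) * f (V n)) π :=
    integrable_nat_mul_poisson r (g := fun n => f (V n)) (hfi _)
  have hVsucc : ∀ n, V (n + 1) = V n + 1 / s := fun n => by
    simp only [hV]; push_cast; field_simp; ring
  -- the Stein–Chen identity for `f ∘ V`
  have hstein : ∫ n, V n * f (V n) ∂π = (r / s) * ∫ n, (f (V n + 1 / s) - f (V n)) ∂π := by
    have h1 := integral_nat_mul_poisson r fun n => f (V n)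
    simp only [hVsucc] at h1
    have e : ∀ n, V n * f (V n) = (1 / s) * ((n : ℝ) * f (V n)) - (r / s) * f (V n) := fun n => by
      simp only [hV]; field_simp
    simp only [e]
    rw [integral_sub (hnf.const_mul _) ((hfi _).const_mul _), integral_const_mul,
      integral_const_mul, h1, integral_sub (hfi _) (hfi _)]
    ring
  set q : ℕ → ℝ := fun n => (f (V n + 1 / s) - f (V n)) / (1 / s) with hq
  have hqi : Integrable q π := ((hfi _).sub (hfi _)).div_const _
  have hqle : ∀ n, |q n| ≤ 20 * (1 + V n ^ 2) := fun n => by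
    have hδ1 : 1 / s ≤ 1 := by rw [div_le_one hs0]; exact hs
    have hδ : 0 < 1 / s := by positivity
    have := abs_steinSol_sub_le hg hgb hg0 hS hgS (w := V n) (t := V n + 1 / s) (by linarith)
      (by linarith)
    rw [add_sub_cancel_left] at this
    simp only [hq]
    rw [abs_div, abs_of_pos hδ, div_le_iff₀ hδ]
    refine this.trans (mul_le_mul_of_nonneg_right ?_ hδ.le)
    rw [← sq_abs]
    nlinarith [sq_nonneg (|V n| - 1), sq_nonneg (|V n|)]
  have hmain : ∫ n, g (V n) ∂π =
      (∫ n, ((V n * f (V n) + g (V n)) - q n) ∂π) - ((r - s ^ 2) / s ^ 2) * ∫ n, q n ∂π := by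
    have i1 : Integrable (fun n => V n * f (V n) + g (V n)) π := hVf.add hgVi
    rw [integral_sub i1 hqi, integral_add hVf hgVi, hstein, hq, integral_div]
    field_simp
    ring
  have hb1 : |∫ n, ((V n * f (V n) + g (V n)) - q n) ∂π| ≤
      120 / s + ∫ n, o (V n) ∂π := by
    have hi : Integrable (fun n => 40 * (1 + V n ^ 2) * (1 / s)) π :=
      (((integrable_const (1 : ℝ)).add hV2i).const_mul 40).mul_const _
    have hle : ∀ n, ‖(V n * f (V n) + g (V n)) - q n‖ ≤ 40 * (1 + V n ^ 2) * (1 / s) + o (V n) := by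
      intro n
      rw [Real.norm_eq_abs, abs_sub_comm]
      refine abs_diffQuot_sub_stein_le hg hgb hg0 hS hgS (by positivity) ?_ ?_
      · rw [div_le_one hs0]; exact hs
      · intro t h1 h2
        simpa [hgdef] using ho (V n) t h1 h2
    have h2 := norm_integral_le_of_norm_le (hi.add hoi) (ae_of_all _ hle)
    rw [integral_add' hi hoi, integral_mul_const, integral_const_mul,
      integral_add (integrable_const _) hV2i] at h2
    simp only [integral_const, probReal_univ, smul_eq_mul, one_mul] at h2
    refine h2.trans (add_le_add_left ?_ _)
    rw [mul_one_div]
    gcongr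
    linarith
  have hb2 : |∫ n, q n ∂π| ≤ 60 := by
    have i1 : Integrable (fun n => 20 * (1 + V n ^ 2)) π :=
      ((integrable_const (1 : ℝ)).add hV2i).const_mul 20
    have h2 := norm_integral_le_of_norm_le (f := q) i1 (ae_of_all π hqle)
    rw [integral_const_mul, integral_add (integrable_const _) hV2i] at h2
    simp only [integral_const, probReal_univ, smul_eq_mul, one_mul] at h2
    have h3 : |∫ n, q n ∂π| ≤ 20 * (1 + ∫ n, V n ^ 2 ∂π) := h2
    linarith
  have hhV : Integrable (fun n => h (V n)) π := by
    refine (hgVi.add (integrable_const m)).congr (ae_of_all _ fun n => ?_)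
    simp [hgdef]
  have hfin : ∫ n, h (V n) ∂π - m = ∫ n, g (V n) ∂π := by
    rw [integral_sub hhV (integrable_const _)]; simp
  rw [hfin, hmain]
  have hc : |((r : ℝ) - s ^ 2) / s ^ 2| ≤ 1 / s := by
    rw [abs_of_nonneg (div_nonneg (by linarith) (by positivity)), div_le_div_iff₀ (by positivity) hs0]
    nlinarith
  calc |(∫ n, ((V n * f (V n) + g (V n)) - q n) ∂π) - ((r - s ^ 2) / s ^ 2) * ∫ n, q n ∂π|
      ≤ |∫ n, ((V n * f (V n) + g (V n)) - q n) ∂π| + |((r : ℝ) - s ^ 2) / s ^ 2| * |∫ n, q n ∂π| := by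
        rw [← abs_mul]; exact abs_sub _ _
    _ ≤ (120 / s + ∫ n, o (V n) ∂π) + 1 / s * 60 := by gcongr
    _ = _ := by ring

/-! ### The Wasserstein metric -/

/-- The difference `1_{t ≤ x} - 1_{0 ≤ x}` of the distribution functions at `x` of the point masses
at `t` and at `0`. -/
def stepDiff (t x : ℝ) : ℝ := (Set.Ici t).indicator 1 x - (Set.Ici (0 : ℝ)).indicator 1 x

lemma measurable_stepDiff : Measurable fun p : ℝ × ℝ => stepDiff p.1 p.2 := by
  have h1 : MeasurableSet {p : ℝ × ℝ | p.1 ≤ p.2} := measurableSet_le measurable_fst measurable_snd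
  have h2 : MeasurableSet {p : ℝ × ℝ | 0 ≤ p.2} := measurableSet_le measurable_const measurable_snd
  exact (measurable_one.indicator h1).sub (measurable_one.indicator h2)

lemma abs_stepDiff_sub (t t' x : ℝ) :
    |stepDiff t x - stepDiff t' x| = (Set.Ico (min t t') (max t t')).indicator 1 x := by
  rw [stepDiff, stepDiff, sub_sub_sub_cancel_right]
  simp only [Set.indicator_apply, Set.mem_Ici, Set.mem_Ico, min_le_iff, lt_max_iff,
    Pi.one_apply]
  rcases le_or_gt t x with h1 | h1 <;> rcases le_or_gt t' x with h2 | h2 <;>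
    simp [h1, h2, not_le.2, not_lt.2]

lemma stepDiff_zero (x : ℝ) : stepDiff 0 x = 0 := by simp [stepDiff]

lemma integral_abs_stepDiff_sub (t t' : ℝ) : ∫ x, |stepDiff t x - stepDiff t' x| = |t - t'| := by
  simp only [abs_stepDiff_sub]
  rw [integral_indicator_one measurableSet_Ico, Real.volume_real_Ico_of_le min_le_max,
    max_sub_min_eq_abs, abs_sub_comm]

lemma integrable_stepDiff (t : ℝ) : Integrable (stepDiff t) := by
  have hm : Measurable (stepDiff t) := measurable_stepDiff.comp measurable_prodMk_left
  have h : Integrable ((Set.Ico (min t 0) (max t 0)).indicator (1 : ℝ → ℝ)) :=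
    (integrableOn_const (by simp)).integrable_indicator measurableSet_Ico
  refine h.mono' hm.aestronglyMeasurable (ae_of_all _ fun x => ?_)
  rw [← abs_stepDiff_sub, stepDiff_zero, sub_zero]
  exact le_rfl

section

variable {μ ν : Measure ℝ}

lemma integrable_stepDiff_prod [SFinite μ] (hμ : Integrable (fun t : ℝ => t) μ) :
    Integrable (fun p : ℝ × ℝ => stepDiff p.1 p.2) (μ.prod volume) := by
  rw [integrable_prod_iff measurable_stepDiff.aestronglyMeasurable]
  refine ⟨ae_of_all _ integrable_stepDiff, hμ.abs.congr (ae_of_all _ fun t => ?_)⟩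
  have := integral_abs_stepDiff_sub t 0
  simp only [stepDiff_zero, sub_zero] at this
  exact this.symm

variable [IsProbabilityMeasure μ] [IsProbabilityMeasure ν]

lemma integral_stepDiff (x : ℝ) :
    ∫ t, stepDiff t x ∂μ = cdf μ x - (Set.Ici (0 : ℝ)).indicator 1 x := by
  have e : ∀ t, stepDiff t x = (Set.Iic x).indicator 1 t - (Set.Ici (0 : ℝ)).indicator 1 x := by
    intro t; simp [stepDiff, Set.indicator_apply]
  have i1 : Integrable ((Set.Iic x).indicator (1 : ℝ → ℝ)) μ :=
    (integrable_const (1 : ℝ)).indicator measurableSet_Iic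
  simp only [e]
  rw [integral_sub i1 (integrable_const _),
    integral_indicator_one measurableSet_Iic, cdf_eq_real]
  simp

lemma integrable_cdf_sub_step (hμ : Integrable (fun t : ℝ => t) μ) :
    Integrable fun x => cdf μ x - (Set.Ici (0 : ℝ)).indicator 1 x := by
  have := (integrable_stepDiff_prod hμ).integral_prod_right
  simpa only [integral_stepDiff] using this

lemma integral_abs_cdf_sub_step_le (hμ : Integrable (fun t : ℝ => t) μ) :
    ∫ x, |cdf μ x - (Set.Ici (0 : ℝ)).indicator 1 x| ≤ ∫ t, |t| ∂μ := by
  have hi := integrable_stepDiff_prod hμ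
  calc ∫ x, |cdf μ x - (Set.Ici (0 : ℝ)).indicator 1 x|
      = ∫ x, |∫ t, stepDiff t x ∂μ| := by simp only [integral_stepDiff]
    _ ≤ ∫ x, ∫ t, |stepDiff t x| ∂μ :=
        integral_mono hi.integral_prod_right.abs hi.abs.integral_prod_right
          fun x => abs_integral_le_integral_abs
    _ = ∫ t, (∫ x, |stepDiff t x|) ∂μ := integral_integral_swap (f := fun x t => |stepDiff t x|) hi.abs.swap
    _ = ∫ t, |t| ∂μ := by
        have e : ∀ t, ∫ x, |stepDiff t x| = |t| := fun t => by
          simpa [stepDiff_zero] using integral_abs_stepDiff_sub t 0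
        simp only [e]

lemma integrable_cdf_sub_cdf (hμ : Integrable (fun t : ℝ => t) μ)
    (hν : Integrable (fun t : ℝ => t) ν) : Integrable fun x => cdf μ x - cdf ν x := by
  refine ((integrable_cdf_sub_step hμ).sub (integrable_cdf_sub_step hν)).congr
    (ae_of_all _ fun x => ?_)
  simp

lemma dW_le_integral_abs_add (hμ : Integrable (fun t : ℝ => t) μ)
    (hν : Integrable (fun t : ℝ => t) ν) : dW μ ν ≤ ∫ t, |t| ∂μ + ∫ t, |t| ∂ν := by
  have h1 := (integrable_cdf_sub_step hμ).abs
  have h2 := (integrable_cdf_sub_step hν).abs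
  refine le_trans ?_ (add_le_add (integral_abs_cdf_sub_step_le hμ) (integral_abs_cdf_sub_step_le hν))
  rw [← integral_add h1 h2]
  refine integral_mono (integrable_cdf_sub_cdf hμ hν).abs (h1.add h2) fun x => ?_
  have := abs_sub (cdf μ x - (Set.Ici (0 : ℝ)).indicator 1 x)
    (cdf ν x - (Set.Ici (0 : ℝ)).indicator 1 x)
  rwa [sub_sub_sub_cancel_right] at this

/-- The primitive of `-a` that vanishes at `0`, written as an integral over `ℝ`. -/
def stepPrimitive (a : ℝ → ℝ) (t : ℝ) : ℝ := ∫ x, a x * stepDiff t x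

lemma integral_mul_cdf_sub_step (hμ : Integrable (fun t : ℝ => t) μ) {a : ℝ → ℝ}
    (ha : Measurable a) (hab : ∀ x, |a x| ≤ 1) :
    ∫ x, a x * (cdf μ x - (Set.Ici (0 : ℝ)).indicator 1 x) = ∫ t, stepPrimitive a t ∂μ := by
  have hi : Integrable (fun p : ℝ × ℝ => a p.2 * stepDiff p.1 p.2) (μ.prod volume) :=
    (integrable_stepDiff_prod hμ).bdd_mul (c := 1) (ha.comp measurable_snd).aestronglyMeasurable
      (ae_of_all _ fun p => hab _)
  calc ∫ x, a x * (cdf μ x - (Set.Ici (0 : ℝ)).indicator 1 x)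
      = ∫ x, ∫ t, a x * stepDiff t x ∂μ := by
        refine integral_congr_ae (ae_of_all _ fun x => ?_)
        simp only [integral_const_mul, integral_stepDiff]
    _ = ∫ t, (∫ x, a x * stepDiff t x) ∂μ :=
        integral_integral_swap (f := fun x t => a x * stepDiff t x) hi.swap

lemma integrable_mul_stepDiff {a : ℝ → ℝ} (ha : Measurable a) (hab : ∀ x, |a x| ≤ 1) (t : ℝ) :
    Integrable fun x => a x * stepDiff t x :=
  (integrable_stepDiff t).bdd_mul (c := 1) ha.aestronglyMeasurable (ae_of_all _ hab)

lemma abs_stepPrimitive_sub_le {a : ℝ → ℝ} (ha : Measurable a) (hab : ∀ x, |a x| ≤ 1) (t t' : ℝ) :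
    |stepPrimitive a t - stepPrimitive a t'| ≤ |t - t'| := by
  rw [stepPrimitive, stepPrimitive, ← integral_sub (integrable_mul_stepDiff ha hab t)
    (integrable_mul_stepDiff ha hab t'), ← integral_abs_stepDiff_sub, ← Real.norm_eq_abs]
  refine norm_integral_le_of_norm_le ((integrable_stepDiff t).sub (integrable_stepDiff t')).abs
    (ae_of_all _ fun x => ?_)
  rw [← mul_sub, norm_mul]
  exact mul_le_of_le_one_left (abs_nonneg _) (hab x)

lemma stepPrimitive_zero (a : ℝ → ℝ) : stepPrimitive a 0 = 0 := by
  simp [stepPrimitive, stepDiff_zero]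

lemma continuous_stepPrimitive {a : ℝ → ℝ} (ha : Measurable a) (hab : ∀ x, |a x| ≤ 1) :
    Continuous (stepPrimitive a) :=
  (LipschitzWith.of_dist_le_mul (K := 1) fun t t' => by
    simpa [Real.dist_eq] using abs_stepPrimitive_sub_le ha hab t t').continuous

/-- Kantorovich duality, in the direction that bounds the metric by a Lipschitz test function. -/
lemma exists_dW_eq (hμ : Integrable (fun t : ℝ => t) μ) (hν : Integrable (fun t : ℝ => t) ν) :
    ∃ a : ℝ → ℝ, Measurable a ∧ (∀ x, |a x| ≤ 1) ∧
      dW μ ν = ∫ t, stepPrimitive a t ∂μ - ∫ t, stepPrimitive a t ∂ν := by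
  set D : ℝ → ℝ := fun x => cdf μ x - cdf ν x
  have hD : Measurable D := (monotone_cdf μ).measurable.sub (monotone_cdf ν).measurable
  set a : ℝ → ℝ := fun x => if 0 ≤ D x then 1 else -1
  have ha : Measurable a :=
    Measurable.ite (measurableSet_le measurable_const hD) measurable_const measurable_const
  have hab : ∀ x, |a x| ≤ 1 := fun x => by simp only [a]; split_ifs <;> simp
  refine ⟨a, ha, hab, ?_⟩
  have h1 := (integrable_cdf_sub_step hμ).bdd_mul (c := 1) ha.aestronglyMeasurable (ae_of_all _ hab)
  have h2 := (integrable_cdf_sub_step hν).bdd_mul (c := 1) ha.aestronglyMeasurable (ae_of_all _ hab)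
  rw [← integral_mul_cdf_sub_step hμ ha hab, ← integral_mul_cdf_sub_step hν ha hab,
    ← integral_sub h1 h2, dW]
  refine integral_congr_ae (ae_of_all _ fun x => ?_)
  simp only [← mul_sub, sub_sub_sub_cancel_right]
  change |D x| = a x * D x
  simp only [a]
  split_ifs with h
  · rw [abs_of_nonneg h, one_mul]
  · rw [abs_of_neg (not_le.1 h)]; ring

end

/-! ### Standardised laws on the integers -/

/-- The law of `(X - a) / s` for an integer-valued `X` with law `μ`. -/
def stdLaw (μ : Measure ℤ) (a s : ℝ) : Measure ℝ := μ.map fun n : ℤ => ((n : ℝ) - a) / s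

instance (μ : Measure ℤ) [IsProbabilityMeasure μ] (a s : ℝ) : IsProbabilityMeasure (stdLaw μ a s) :=
  Measure.isProbabilityMeasure_map .of_discrete

lemma cdf_stdLaw (μ : Measure ℤ) [IsProbabilityMeasure μ] (a : ℝ) {s : ℝ} (hs : 0 < s) (x : ℝ) :
    cdf (stdLaw μ a s) x = intCdf μ ⌊a + s * x⌋ := by
  rw [cdf_eq_real, stdLaw, measureReal_def, Measure.map_apply (by fun_prop) measurableSet_Iic, intCdf,
    measureReal_def]
  congr 2
  ext n
  simp only [Set.mem_preimage, Set.mem_Iic, Int.le_floor]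
  rw [div_le_iff₀ hs]
  constructor <;> intro h <;> linarith

lemma abs_intCdf_sub_le {μ ν : Measure ℤ} [IsProbabilityMeasure μ] [IsProbabilityMeasure ν] (a : ℝ)
    {s : ℝ} (hs : 0 < s) {A B : ℝ} {Φ : ℝ → ℝ} (hμ : ∀ x, |cdf (stdLaw μ a s) x - Φ x| ≤ A)
    (hν : ∀ x, |cdf (stdLaw ν a s) x - Φ x| ≤ B) :
    SupBound (fun j => intCdf μ j - intCdf ν j) (A + B) := by
  intro j
  have e : a + s * (((j : ℝ) - a) / s) = j := by field_simp; ring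
  have h1 := hμ (((j : ℝ) - a) / s)
  have h2 := hν (((j : ℝ) - a) / s)
  rw [cdf_stdLaw _ _ hs, e, Int.floor_intCast] at h1 h2
  have := abs_sub_le (intCdf μ j) (Φ (((j : ℝ) - a) / s)) (intCdf ν j)
  rw [abs_sub_comm (Φ _)] at this
  exact this.trans (add_le_add h1 h2)

/-- On the scale of the integers the Wasserstein distance is an `ℓ¹` norm. -/
lemma l1Bound_intCdf_sub {μ ν : Measure ℤ} [IsProbabilityMeasure μ] [IsProbabilityMeasure ν] (a : ℝ)
    {s : ℝ} (hs : 0 < s)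
    (hi : Integrable fun x => cdf (stdLaw μ a s) x - cdf (stdLaw ν a s) x) :
    L1Bound (fun j => intCdf μ j - intCdf ν j) (s * dW (stdLaw μ a s) (stdLaw ν a s)) := by
  intro S
  set D : ℤ → ℝ := fun j => |intCdf μ j - intCdf ν j|
  have hD : (fun x => |cdf (stdLaw μ a s) x - cdf (stdLaw ν a s) x|) = fun x => D ⌊a + s * x⌋ := by
    ext x; rw [cdf_stdLaw _ _ hs, cdf_stdLaw _ _ hs]
  have hi' : Integrable fun x : ℝ => D ⌊a + s * x⌋ := hD ▸ hi.abs
  have hi2 : Integrable fun y : ℝ => D ⌊y⌋ := by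
    have h := (integrable_comp_mul_left_iff (fun y => D ⌊a + y⌋) hs.ne').1 hi'
    have := h.comp_sub_right a
    simpa using this
  have hint : dW (stdLaw μ a s) (stdLaw ν a s) = s⁻¹ * ∫ y : ℝ, D ⌊y⌋ := by
    rw [dW, hD, Measure.integral_comp_mul_left (fun y => D ⌊a + y⌋) s,
      integral_add_left_eq_self (fun y : ℝ => D ⌊y⌋) a, abs_of_pos (inv_pos.2 hs), smul_eq_mul]
  rw [hint, mul_inv_cancel_left₀ hs.ne']
  have hcell : ∀ j : ℤ, ∫ y : ℝ, (Set.Ico (j : ℝ) (j + 1)).indicator (fun _ => D j) y = D j := fun j => by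
    rw [integral_indicator measurableSet_Ico, setIntegral_const]
    simp
  have hcelli : ∀ j : ℤ, Integrable ((Set.Ico (j : ℝ) (j + 1)).indicator fun _ => D j) := fun j =>
    (integrableOn_const (by simp)).integrable_indicator measurableSet_Ico
  calc ∑ j ∈ S, D j
      = ∫ y : ℝ, ∑ j ∈ S, (Set.Ico (j : ℝ) (j + 1)).indicator (fun _ => D j) y := by
        rw [integral_finsetSum _ fun j _ => hcelli j]
        simp only [hcell]
    _ ≤ ∫ y : ℝ, D ⌊y⌋ := by
        refine integral_mono (integrable_finsetSum _ fun j _ => hcelli j) hi2 fun y => ?_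
        have e : ∀ j : ℤ, (Set.Ico (j : ℝ) (j + 1)).indicator (fun _ => D j) y =
            if ⌊y⌋ = j then D j else 0 := fun j => by
          rw [Set.indicator_apply]
          exact if_congr (by rw [Int.floor_eq_iff, Set.mem_Ico]) rfl rfl
        simp only [e, Finset.sum_ite_eq]
        split_ifs
        · exact le_rfl
        · exact abs_nonneg _

/-! ### A lower bound for the distance of a lattice law to the normal law -/

lemma mul_le_cdf_gaussian_sub {a b : ℝ} (ha : 0 ≤ a) (hab : a ≤ b) (hb : b ≤ 2) :
    gaussianPDFReal 0 1 2 * (b - a) ≤ cdf (gaussianReal 0 1) b - cdf (gaussianReal 0 1) a := by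
  have e : cdf (gaussianReal 0 1) b - cdf (gaussianReal 0 1) a =
      ∫ x in Set.Ioc a b, gaussianPDFReal 0 1 x := by
    have h : Set.Iic b = Set.Iic a ∪ Set.Ioc a b := (Set.Iic_union_Ioc_eq_Iic hab).symm
    rw [cdf_eq_real, cdf_eq_real, h, measureReal_union (Set.Iic_disjoint_Ioc le_rfl)
      measurableSet_Ioc, add_sub_cancel_left, measureReal_def,
      gaussianReal_apply_eq_integral _ one_ne_zero, ENNReal.toReal_ofReal]
    exact integral_nonneg fun x => gaussianPDFReal_nonneg _ _ _
  have h2 : ∫ x in Set.Ioc a b, gaussianPDFReal 0 1 2 = gaussianPDFReal 0 1 2 * (b - a) := by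
    rw [setIntegral_const, Real.volume_real_Ioc_of_le hab, smul_eq_mul, mul_comm]
  rw [e, ← h2]
  refine setIntegral_mono_on (integrableOn_const (by simp))
    (integrable_gaussianPDFReal 0 1).integrableOn measurableSet_Ioc fun x hx => ?_
  simp only [gaussianPDFReal]
  gcongr ?_ * Real.exp ?_
  simp only [sub_zero, NNReal.coe_one, mul_one]
  have : x ^ 2 ≤ 2 ^ 2 := pow_le_pow_left₀ (ha.trans hx.1.le) (hx.2.trans hb) 2
  linarith

/-- Among three points at distance `1 / (2 s)`, two neighbouring ones see the same value of the
distribution function of a law on a lattice of span `1 / s`. -/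
lemma lattice_lower_bound {μ : Measure ℤ} [IsProbabilityMeasure μ] (a : ℝ) {s : ℝ} (hs : 1 ≤ s)
    {x : ℝ} (hx0 : 0 ≤ x) (hx1 : x ≤ 1) {D : ℝ → ℝ}
    (hD : ∀ x, D x = |cdf (stdLaw μ a s) x - cdf (gaussianReal 0 1) x|) :
    gaussianPDFReal 0 1 2 / (2 * s) ≤
      D x + 2 * D (x + 1 / (2 * s)) + D (x + 1 / s) := by
  have hs0 : 0 < s := by linarith
  have hs1 : 1 / s ≤ 1 := by rw [div_le_one hs0]; exact hs
  have h2s : 1 / s = 1 / (2 * s) + 1 / (2 * s) := by field_simp; ring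
  have hpos : 0 < 1 / (2 * s) := by positivity
  set F := fun x => cdf (stdLaw μ a s) x
  set Φ := fun x => cdf (gaussianReal 0 1) x
  have hF : ∀ x, F x = intCdf μ ⌊a + s * x⌋ := fun x => cdf_stdLaw μ a hs0 x
  have e1 : a + s * (x + 1 / (2 * s)) = a + s * x + 1 / 2 := by field_simp; ring
  have e2 : a + s * (x + 1 / s) = a + s * x + 1 := by field_simp; ring
  have hcase : F x = F (x + 1 / (2 * s)) ∨ F (x + 1 / (2 * s)) = F (x + 1 / s) := by
    rw [hF, hF, hF, e1, e2]
    have h1 : ⌊a + s * x⌋ ≤ ⌊a + s * x + 1 / 2⌋ := Int.floor_mono (by linarith)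
    have h2 : ⌊a + s * x + 1 / 2⌋ ≤ ⌊a + s * x + 1⌋ := Int.floor_mono (by linarith)
    have h3 : ⌊a + s * x + 1⌋ = ⌊a + s * x⌋ + 1 := Int.floor_add_one _
    rcases (by omega : ⌊a + s * x⌋ = ⌊a + s * x + 1 / 2⌋ ∨
        ⌊a + s * x + 1 / 2⌋ = ⌊a + s * x + 1⌋) with h | h
    · left; rw [h]
    · right; rw [h]
  have hDn : ∀ x, 0 ≤ D x := fun x => hD x ▸ abs_nonneg _
  have hstep : ∀ p q, F p = F q → Φ q - Φ p ≤ D p + D q := by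
    intro p q hpq
    rw [hD, hD]
    have h1 := le_abs_self (F p - Φ p)
    have h2 := neg_abs_le (F q - Φ q)
    change Φ q - Φ p ≤ |F p - Φ p| + |F q - Φ q|
    linarith
  have g1 := mul_le_cdf_gaussian_sub hx0 (b := x + 1 / (2 * s)) (by linarith) (by linarith)
  have g2 := mul_le_cdf_gaussian_sub (a := x + 1 / (2 * s)) (b := x + 1 / s) (by linarith)
    (by linarith) (by linarith)
  have e3 : gaussianPDFReal 0 1 2 * (x + 1 / (2 * s) - x) = gaussianPDFReal 0 1 2 / (2 * s) := by ring
  have e4 : gaussianPDFReal 0 1 2 * (x + 1 / s - (x + 1 / (2 * s))) =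
      gaussianPDFReal 0 1 2 / (2 * s) := by rw [h2s]; ring
  rw [e3] at g1
  rw [e4] at g2
  rcases hcase with h | h
  · linarith [hstep _ _ h, hDn (x + 1 / (2 * s)), hDn (x + 1 / s)]
  · linarith [hstep _ _ h, hDn (x + 1 / (2 * s)), hDn x]

lemma bddAbove_abs_cdf_sub (μ ν : Measure ℝ) :
    BddAbove (Set.range fun x => |cdf μ x - cdf ν x|) := by
  refine ⟨1, ?_⟩
  rintro _ ⟨x, rfl⟩
  exact abs_sub_le_of_nonneg_of_le (cdf_nonneg _ _) (cdf_le_one _ _) (cdf_nonneg _ _) (cdf_le_one _ _)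

lemma abs_cdf_sub_le_dK (μ ν : Measure ℝ) (x : ℝ) : |cdf μ x - cdf ν x| ≤ dK μ ν :=
  le_ciSup (bddAbove_abs_cdf_sub μ ν) x

lemma dK_le_one (μ ν : Measure ℝ) : dK μ ν ≤ 1 :=
  ciSup_le fun _ => abs_sub_le_of_nonneg_of_le (cdf_nonneg _ _) (cdf_le_one _ _) (cdf_nonneg _ _)
    (cdf_le_one _ _)

lemma le_dK_stdLaw {μ : Measure ℤ} [IsProbabilityMeasure μ] (a : ℝ) {s : ℝ} (hs : 1 ≤ s) :
    gaussianPDFReal 0 1 2 / 8 / s ≤ dK (stdLaw μ a s) (gaussianReal 0 1) := by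
  have h := lattice_lower_bound (μ := μ) a hs (x := 0) le_rfl zero_le_one (D := _) fun _ => rfl
  have hb := abs_cdf_sub_le_dK (stdLaw μ a s) (gaussianReal 0 1)
  have h1 := hb 0
  have h2 := hb (0 + 1 / (2 * s))
  have h3 := hb (0 + 1 / s)
  have e : gaussianPDFReal 0 1 2 / 8 / s = gaussianPDFReal 0 1 2 / (2 * s) / 4 := by
    field_simp; ring
  rw [e]; linarith

lemma le_dW_stdLaw {μ : Measure ℤ} [IsProbabilityMeasure μ] (a : ℝ) {s : ℝ} (hs : 1 ≤ s)
    (hμ : Integrable (fun t : ℝ => t) (stdLaw μ a s)) :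
    gaussianPDFReal 0 1 2 / 8 / s ≤ dW (stdLaw μ a s) (gaussianReal 0 1) := by
  set D : ℝ → ℝ := fun x => |cdf (stdLaw μ a s) x - cdf (gaussianReal 0 1) x| with hD
  have hi : Integrable D := (integrable_cdf_sub_cdf hμ integrable_id_gaussian).abs
  have i1 := hi.comp_add_right (1 / (2 * s))
  have i2 := hi.comp_add_right (1 / s)
  have i3 : Integrable fun x => D x + 2 * D (x + 1 / (2 * s)) := hi.add (i1.const_mul 2)
  have i4 : Integrable fun x => D x + 2 * D (x + 1 / (2 * s)) + D (x + 1 / s) := i3.add i2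
  have htot : ∫ x, (D x + 2 * D (x + 1 / (2 * s)) + D (x + 1 / s)) = 4 * ∫ x, D x := by
    rw [integral_add i3 i2, integral_add hi (i1.const_mul 2), integral_const_mul,
      integral_add_right_eq_self D, integral_add_right_eq_self D]
    ring
  have hle : ∫ x in Set.Icc (0 : ℝ) 1, gaussianPDFReal 0 1 2 / (2 * s) ≤
      ∫ x in Set.Icc (0 : ℝ) 1, (D x + 2 * D (x + 1 / (2 * s)) + D (x + 1 / s)) :=
    setIntegral_mono_on (integrableOn_const (by simp)) i4.integrableOn measurableSet_Icc
      fun x hx => lattice_lower_bound a hs hx.1 hx.2 fun _ => rfl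
  have hle2 : ∫ x in Set.Icc (0 : ℝ) 1, (D x + 2 * D (x + 1 / (2 * s)) + D (x + 1 / s)) ≤
      ∫ x, (D x + 2 * D (x + 1 / (2 * s)) + D (x + 1 / s)) :=
    setIntegral_le_integral i4 (ae_of_all _ fun x => by
      change 0 ≤ D x + 2 * D (x + 1 / (2 * s)) + D (x + 1 / s)
      simp only [hD]; positivity)
  rw [setIntegral_const] at hle
  simp only [Real.volume_real_Icc_of_le zero_le_one, sub_zero, one_smul] at hle
  have hdW : dW (stdLaw μ a s) (gaussianReal 0 1) = ∫ x, D x := rfl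
  have e : gaussianPDFReal 0 1 2 / 8 / s = gaussianPDFReal 0 1 2 / (2 * s) / 4 := by
    field_simp; ring
  rw [e, hdW]; linarith

/-! ### The translated Poisson law in the Kolmogorov and Wasserstein metrics -/

open scoped NNReal

lemma poisson_real_singleton_le {r : ℝ≥0} (hr : 0 < r) (n : ℕ) :
    (poissonMeasure r).real {n} ≤ 1 / √(r : ℝ) := by
  have h : SmoothBy ((poissonMeasure r).map ((↑) : ℕ → ℤ)) ((Polynomial.X - 1) ^ 1) (1 / √(r : ℝ)) := by
    simpa using smoothBy_poisson hr
  have := h.supBound_intCdf ((n : ℤ) - 1)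
  rw [Function.iterate_one, intCdf_succ, sub_add_cancel, measureReal_def,
    Measure.map_apply (by fun_prop) (by measurability)] at this
  have e : ((↑) : ℕ → ℤ) ⁻¹' {(n : ℤ)} = {n} := by ext; simp
  rw [e, abs_of_nonneg ENNReal.toReal_nonneg] at this
  exact this

lemma abs_cdf_poisson_sub_gaussian_le {r : ℝ≥0} {s : ℝ} (hs : 1 ≤ s) (hr1 : s ^ 2 ≤ r)
    (hr2 : (r : ℝ) ≤ s ^ 2 + 1) (x : ℝ) :
    |cdf ((poissonMeasure r).map fun n : ℕ => ((n : ℝ) - r) / s) x - cdf (gaussianReal 0 1) x| ≤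
      181 / s := by
  have hs0 : 0 < s := by linarith
  have hr0 : (0 : ℝ) < r := lt_of_lt_of_le (by positivity) hr1
  have hprob : IsProbabilityMeasure ((poissonMeasure r).map fun n : ℕ => ((n : ℝ) - r) / s) :=
    Measure.isProbabilityMeasure_map .of_discrete
  set h : ℝ → ℝ := (Set.Iic x).indicator 1
  set o : ℝ → ℝ := fun w => (Set.Ioc (x - 1 / s) x).indicator 1 w
  have hh : Measurable h := measurable_one.indicator measurableSet_Iic
  have ho : ∀ w t, w ≤ t → t ≤ w + 1 / s → |h t - h w| ≤ o w := by
    intro w t hwt htw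
    by_cases hw : w ≤ x
    · by_cases ht : t ≤ x
      · simp only [h, o, Set.indicator_apply, Set.mem_Iic, hw, ht, if_true]
        simp only [Pi.one_apply, sub_self, abs_zero]
        split_ifs <;> simp
      · have : w ∈ Set.Ioc (x - 1 / s) x := ⟨by linarith [not_le.1 ht], hw⟩
        simp only [o, Set.indicator_of_mem this]
        simp [h, hw, ht]
    · have ht : ¬ t ≤ x := fun h => hw (hwt.trans h)
      simp only [h, o, Set.indicator_apply, Set.mem_Iic, hw, ht, if_false, sub_self, abs_zero]
      split_ifs <;> simp
  -- at most one atom of the Poisson law lies in a window of length `1 / s`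
  have hatom : ∀ n : ℕ, o (((n : ℝ) - r) / s) ≤ ({⌊r + s * x⌋₊} : Set ℕ).indicator 1 n := by
    intro n
    by_cases hn : ((n : ℝ) - r) / s ∈ Set.Ioc (x - 1 / s) x
    · have h1 : (n : ℝ) ≤ r + s * x := by
        have := hn.2
        rw [div_le_iff₀ hs0] at this; linarith
      have h2 : r + s * x < n + 1 := by
        have := hn.1
        rw [lt_div_iff₀ hs0, sub_mul, one_div, inv_mul_cancel₀ hs0.ne'] at this
        linarith
      have h3 : ⌊r + s * x⌋₊ = n := by
        rw [Nat.floor_eq_iff (le_trans (Nat.cast_nonneg n) h1)]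
        exact ⟨h1, h2⟩
      simp only [o, h3, Set.indicator_of_mem hn, Set.indicator_of_mem (Set.mem_singleton n)]
      exact le_rfl
    · simp only [o, Set.indicator_of_notMem hn]
      exact Set.indicator_nonneg (fun _ _ => zero_le_one) _
  have hoi : Integrable (fun n : ℕ => o (((n : ℝ) - r) / s)) (poissonMeasure r) :=
    Integrable.of_bound (measurable_of_countable _).aestronglyMeasurable 1 (ae_of_all _ fun n => by
      simp only [o, Set.indicator_apply]; split_ifs <;> simp)
  have key := abs_integral_poisson_sub_gaussian_le hs hr1 hr2 hh (fun t => by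
      simp only [h, Set.indicator_apply]
      split_ifs <;> simp; positivity) (Set.countable_singleton x) (fun t ht => by
      rcases lt_or_gt_of_ne (Set.mem_singleton_iff.not.1 ht) with hlt | hlt
      · refine (continuousAt_const (y := (1 : ℝ))).congr ?_
        filter_upwards [Iio_mem_nhds hlt] with y hy
        simp [h, le_of_lt (Set.mem_Iio.1 hy)]
      · refine (continuousAt_const (y := (0 : ℝ))).congr ?_
        filter_upwards [Ioi_mem_nhds hlt] with y hy
        simp [h, not_le.2 (Set.mem_Ioi.1 hy)]) ho hoi
  have e1 : ∫ n : ℕ, h (((n : ℝ) - r) / s) ∂(poissonMeasure r) =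
      cdf ((poissonMeasure r).map fun n : ℕ => ((n : ℝ) - r) / s) x := by
    rw [cdf_eq_real, ← integral_indicator_one measurableSet_Iic,
      integral_map (by fun_prop) hh.aestronglyMeasurable]
  have e2 : ∫ y, h y ∂(gaussianReal 0 1) = cdf (gaussianReal 0 1) x := by
    rw [cdf_eq_real, integral_indicator_one measurableSet_Iic]
  rw [e1, e2] at key
  refine key.trans ?_
  have h3 : ∫ n : ℕ, o (((n : ℝ) - r) / s) ∂(poissonMeasure r) ≤ 1 / s := by
    calc ∫ n : ℕ, o (((n : ℝ) - r) / s) ∂(poissonMeasure r)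
        ≤ ∫ n : ℕ, ({⌊r + s * x⌋₊} : Set ℕ).indicator 1 n ∂(poissonMeasure r) :=
          integral_mono hoi ((integrable_const (1 : ℝ)).indicator (by measurability)) hatom
      _ = (poissonMeasure r).real {⌊r + s * x⌋₊} := integral_indicator_one (by measurability)
      _ ≤ 1 / √(r : ℝ) := poisson_real_singleton_le (by exact_mod_cast hr0) _
      _ ≤ 1 / s := by
        gcongr
        exact Real.le_sqrt_of_sq_le hr1
  calc 180 / s + ∫ n : ℕ, o (((n : ℝ) - r) / s) ∂(poissonMeasure r) ≤ 180 / s + 1 / s := by gcongr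
    _ = 181 / s := by ring

lemma dW_poisson_gaussian_le {r : ℝ≥0} {s : ℝ} (hs : 1 ≤ s) (hr1 : s ^ 2 ≤ r)
    (hr2 : (r : ℝ) ≤ s ^ 2 + 1) :
    dW ((poissonMeasure r).map fun n : ℕ => ((n : ℝ) - r) / s) (gaussianReal 0 1) ≤ 181 / s := by
  have hs0 : 0 < s := by linarith
  have hprob : IsProbabilityMeasure ((poissonMeasure r).map fun n : ℕ => ((n : ℝ) - r) / s) :=
    Measure.isProbabilityMeasure_map .of_discrete
  have hint : Integrable (fun t : ℝ => t) ((poissonMeasure r).map fun n : ℕ => ((n : ℝ) - r) / s) := by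
    rw [integrable_map_measure (by fun_prop) (by fun_prop)]
    exact ((integrable_poisson_id r).sub (integrable_const _)).div_const s
  obtain ⟨a, ha, hab, h⟩ := exists_dW_eq hint integrable_id_gaussian
  have hcont := continuous_stepPrimitive ha hab
  have key := abs_integral_poisson_sub_gaussian_le hs hr1 hr2 hcont.measurable (fun t => by
      have := abs_stepPrimitive_sub_le ha hab t 0
      rw [stepPrimitive_zero, sub_zero, sub_zero] at this
      linarith) Set.countable_empty (fun t _ => hcont.continuousAt) (o := fun _ => 1 / s)
    (fun w t hwt htw => by
      refine (abs_stepPrimitive_sub_le ha hab t w).trans ?_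
      rw [abs_of_nonneg (by linarith)]; linarith) (integrable_const _)
  rw [h, integral_map (by fun_prop) hcont.aestronglyMeasurable]
  refine (le_abs_self _).trans (key.trans (le_of_eq ?_))
  simp only [integral_const, probReal_univ, smul_eq_mul, one_mul]
  ring

/-- Standardised by `a` and `s`, the law `TP(a, s²)` is a Poisson law centred at its mean. -/
lemma exists_stdLaw_translatedPoisson (a s : ℝ) :
    ∃ r : ℝ≥0, s ^ 2 ≤ r ∧ (r : ℝ) ≤ s ^ 2 + 1 ∧ stdLaw (translatedPoisson a (s ^ 2)) a s =
      (poissonMeasure r).map fun n : ℕ => ((n : ℝ) - r) / s := by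
  have hf := Int.fract_nonneg (a - s ^ 2)
  have hf1 := Int.fract_lt_one (a - s ^ 2)
  have hc : (((s ^ 2 + Int.fract (a - s ^ 2)).toNNReal : ℝ≥0) : ℝ) = s ^ 2 + Int.fract (a - s ^ 2) :=
    Real.coe_toNNReal _ (by positivity)
  refine ⟨(s ^ 2 + Int.fract (a - s ^ 2)).toNNReal, by rw [hc]; linarith, by rw [hc]; linarith, ?_⟩
  rw [stdLaw, translatedPoisson, Measure.map_map (by fun_prop) (by fun_prop)]
  congr 1
  ext n
  simp only [Function.comp, hc]
  have := Int.fract_add_floor (a - s ^ 2)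
  push_cast
  congr 1
  linarith

instance (a s : ℝ) : IsProbabilityMeasure (translatedPoisson a s) :=
  Measure.isProbabilityMeasure_map .of_discrete

lemma integrable_stdLaw_translatedPoisson (a s : ℝ) :
    Integrable (fun t : ℝ => t) (stdLaw (translatedPoisson a (s ^ 2)) a s) := by
  obtain ⟨r, _, _, hr⟩ := exists_stdLaw_translatedPoisson a s
  rw [hr, integrable_map_measure (by fun_prop) (by fun_prop)]
  exact ((integrable_poisson_id r).sub (integrable_const _)).div_const s

/-! ### Bounds for one pair of laws -/

lemma dW_triangle {μ ν ρ : Measure ℝ} [IsProbabilityMeasure μ] [IsProbabilityMeasure ν]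
    [IsProbabilityMeasure ρ] (hμ : Integrable (fun t : ℝ => t) μ)
    (hν : Integrable (fun t : ℝ => t) ν) (hρ : Integrable (fun t : ℝ => t) ρ) :
    dW μ ν ≤ dW μ ρ + dW ν ρ := by
  have h1 := (integrable_cdf_sub_cdf hμ hρ).abs
  have h2 := (integrable_cdf_sub_cdf hν hρ).abs
  rw [dW, dW, dW, ← integral_add h1 h2]
  refine integral_mono (integrable_cdf_sub_cdf hμ hν).abs (h1.add h2) fun x => ?_
  have := abs_sub_le (cdf μ x) (cdf ρ x) (cdf ν x)
  rwa [abs_sub_comm (cdf ρ x)] at this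

lemma dW_gaussian_le_two {μ : Measure ℝ} [IsProbabilityMeasure μ]
    (hμ : Integrable (fun t : ℝ => t) μ) (hμ2 : Integrable (fun t : ℝ => t ^ 2) μ)
    (h1 : ∫ t, t ^ 2 ∂μ = 1) : dW μ (gaussianReal 0 1) ≤ 2 := by
  have i1 : Integrable (fun x : ℝ => 1 / (2 * 1) * x ^ 2) μ := hμ2.const_mul _
  have h := integral_mono (μ := μ) hμ.abs (i1.add (integrable_const (1 / 2 : ℝ)))
    fun x => abs_le_sq_div_add one_pos
  rw [integral_add' i1 (integrable_const _), integral_const_mul, h1] at h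
  simp only [integral_const, probReal_univ, smul_eq_mul, one_mul] at h
  have := dW_le_integral_abs_add hμ integrable_id_gaussian
  linarith [integral_abs_gaussian_le]

lemma l1Norm_le_of_l1Bound {f : ℤ → ℝ} {c : ℝ} (h : L1Bound f c) : l1Norm f ≤ c :=
  Real.tsum_le_of_sum_le (fun _ => abs_nonneg _) h

lemma L1Bound.supBound {f : ℤ → ℝ} {c : ℝ} (h : L1Bound f c) : SupBound f c := fun j => by
  simpa using h {j}

lemma IsShiftNorm.sub {B : (ℤ → ℝ) → ℝ → Prop} (hB : IsShiftNorm B) {f g : ℤ → ℝ} {c d : ℝ}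
    (hf : B f c) (hg : B g d) : B (f - g) (c + d) := by
  have := hB.add hf (hB.smul (-1) hg)
  rw [abs_neg, abs_one, one_mul, neg_one_smul, ← sub_eq_add_neg] at this
  exact this

lemma fwdDiff_iter_sub (n : ℕ) (f g : ℤ → ℝ) :
    (fwdDiff (1 : ℤ))^[n] (f - g) = (fwdDiff (1 : ℤ))^[n] f - (fwdDiff (1 : ℤ))^[n] g := by
  simp only [← shiftAct_X_sub_one_pow, map_sub]

lemma smoothBy_one_of_finite (μ : Measure ℤ) [IsFiniteMeasure μ] :
    SmoothBy μ ((Polynomial.X - 1) ^ 0) (μ.real Set.univ) := by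
  intro G c hG a
  have h : ∀ x, ‖G (a - x)‖ ≤ c := fun x => hG (a - x)
  have := norm_integral_le_of_norm_le_const (μ := μ) (ae_of_all _ h)
  rw [mul_comm] at this
  simpa [intConv, shiftAct] using this

lemma fwdDiff_intCdf_sub {μ₁ μ₂ ν μ : Measure ℤ} (hμ : intCdf μ = intCdf μ₁ + intCdf μ₂) :
    (fun j => fwdDiff 1 (intCdf μ) j - fwdDiff 1 (intCdf ν) j) =
      fwdDiff 1 ((intCdf μ₁ - intCdf ν) + intCdf μ₂) := by
  ext j
  simp only [fwdDiff, hμ, Pi.add_apply, Pi.sub_apply]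
  ring

section

variable {μ₁ μ₂ ν μ : Measure ℤ} [IsFiniteMeasure μ₁] [IsFiniteMeasure μ₂] [IsFiniteMeasure ν]

/-- Smoothing in the total variation metric, for a law `μ = μ₁ + μ₂` of which only the part `μ₁`
is smooth. -/
lemma dTV_le_of_smoothBy (hμ : intCdf μ = intCdf μ₁ + intCdf μ₂) {n : ℕ} {K₁ K₂ A : ℝ}
    (h₁ : SmoothBy μ₁ ((Polynomial.X - 1) ^ n) K₁) (h₂ : SmoothBy ν ((Polynomial.X - 1) ^ n) K₂)
    (hA : L1Bound (fun j => intCdf μ j - intCdf ν j) A) {h : ℕ} (hh : 0 < h) :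
    2 * dTV μ ν ≤ (2 * h) ^ n * (K₁ + K₂) + 2 ^ n * μ₂.real Set.univ + 2 ^ n * (2 / h * A) := by
  have e : (intCdf μ₁ - intCdf ν) + intCdf μ₂ = fun j => intCdf μ j - intCdf ν j := by
    ext j; simp only [hμ, Pi.add_apply, Pi.sub_apply]; ring
  have hB := isShiftNorm_l1Bound
  have hd : L1Bound ((fwdDiff (1 : ℤ))^[n + 1] (intCdf μ₁ - intCdf ν)) (K₁ + K₂) := by
    rw [fwdDiff_iter_sub]
    exact hB.sub h₁.l1Bound_intCdf h₂.l1Bound_intCdf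
  have := smoothing_bound hB L1Bound.mono L1Bound.nonneg hh n (intCdf μ₁ - intCdf ν) (intCdf μ₂) hd
    (smoothBy_one_of_finite μ₂).l1Bound_intCdf (opBound_movAvg_sq_mul hB hh _ _ (e ▸ hA))
  rw [dTV, fwdDiff_intCdf_sub hμ]
  linarith [l1Norm_le_of_l1Bound this]

/-- Smoothing in the local metric. -/
lemma dLoc_le_of_smoothBy (hμ : intCdf μ = intCdf μ₁ + intCdf μ₂) {n : ℕ} {K₁ K₂ R : ℝ}
    (h₁ : SmoothBy μ₁ ((Polynomial.X - 1) ^ (n + 1)) K₁)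
    (h₂ : SmoothBy ν ((Polynomial.X - 1) ^ (n + 1)) K₂) {h : ℕ} (hh : 0 < h)
    (hR : SupBound (shiftAct (movAvg h ^ 2 * (Polynomial.X - 1))
      (fun j => intCdf μ j - intCdf ν j)) R) :
    dLoc μ ν ≤ (2 * h) ^ n * (K₁ + K₂) + 2 ^ n * μ₂.real Set.univ + 2 ^ n * R := by
  have e : (intCdf μ₁ - intCdf ν) + intCdf μ₂ = fun j => intCdf μ j - intCdf ν j := by
    ext j; simp only [hμ, Pi.add_apply, Pi.sub_apply]; ring
  have hB := isShiftNorm_supBound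
  have hd : SupBound ((fwdDiff (1 : ℤ))^[n + 1] (intCdf μ₁ - intCdf ν)) (K₁ + K₂) := by
    rw [fwdDiff_iter_sub]
    exact hB.sub h₁.supBound_intCdf h₂.supBound_intCdf
  have := smoothing_bound hB SupBound.mono SupBound.nonneg hh n (intCdf μ₁ - intCdf ν) (intCdf μ₂) hd
    (smoothBy_one_of_finite μ₂).l1Bound_intCdf.supBound (e ▸ hR)
  rw [dLoc, fwdDiff_intCdf_sub hμ, supNorm]
  exact ciSup_le this

end

/-! ### Choice of the smoothing scale -/

lemma rpow_le_mul_rpow {d a b : ℝ} (hd : 0 < d) (hd2 : d ≤ 2) (hab : b ≤ a) :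
    d ^ a ≤ 2 ^ (a - b) * d ^ b := by
  have : d ^ a = d ^ (a - b) * d ^ b := by rw [← Real.rpow_add hd]; ring_nf
  rw [this]
  gcongr

/-- The scale `h ≈ d ^ θ s` balances the terms of the smoothing bounds. It is admissible because
`d ^ θ s` stays away from zero, thanks to `c / s ≤ d`; the same inequality turns the
mass `p` of the rough part into a power of `d`. -/
lemma exists_rate {c θ e q K M C : ℝ} {m : ℕ} (hc : 0 < c) (hθ0 : 0 ≤ θ) (hθ1 : θ ≤ 1)
    (hm : e ≤ m * θ) (he : 0 ≤ e) (hq : e ≤ q) (hK : 0 ≤ K) (hM : 0 ≤ M) :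
    ∃ C', ∀ (d s x p : ℝ) (R : ℕ → ℝ), 1 ≤ s → c / s ≤ d → d ≤ 2 → p ≤ M * (1 / s) ^ q →
      (∀ h : ℕ, d ^ θ * s ≤ h → R h ≤ C * d ^ e) →
      (∀ h : ℕ, 0 < h → x ≤ (2 * h) ^ m * (K / s ^ m) + 2 ^ m * p + 2 ^ m * R h) →
      x ≤ C' * d ^ e := by
  set H := 1 + 2 / c with hH
  refine ⟨2 ^ m * (H ^ m * K * 2 ^ (m * θ - e) + M * (1 / c) ^ q * 2 ^ (q - e) + C), ?_⟩
  intro d s x p R hs hcd hd2 hp hR hx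
  have hs0 : 0 < s := by linarith
  have hd : 0 < d := lt_of_lt_of_le (by positivity) hcd
  have hsd : 1 / s ≤ d / c := by
    rw [div_le_div_iff₀ hs0 hc, one_mul]
    rwa [div_le_iff₀ hs0] at hcd
  have hε : 1 ≤ 2 / c * (d ^ θ * s) := by
    have h1 := rpow_le_mul_rpow hd hd2 hθ1
    rw [Real.rpow_one] at h1
    have h2 : (2 : ℝ) ^ (1 - θ) ≤ 2 := by
      calc (2 : ℝ) ^ (1 - θ) ≤ 2 ^ (1 : ℝ) :=
            Real.rpow_le_rpow_of_exponent_le one_le_two (by linarith)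
        _ = 2 := Real.rpow_one 2
    have h3 : d ≤ 2 * d ^ θ := h1.trans (by gcongr)
    calc (1 : ℝ) = s * (1 / s) := by field_simp
      _ ≤ s * (d / c) := by gcongr
      _ ≤ s * (2 * d ^ θ / c) := by gcongr
      _ = 2 / c * (d ^ θ * s) := by ring
  set h := ⌈d ^ θ * s⌉₊ with hh
  have hpos : 0 < d ^ θ * s := by positivity
  have hh0 : 0 < h := Nat.ceil_pos.2 hpos
  have hle : d ^ θ * s ≤ h := Nat.le_ceil _
  have hge : (h : ℝ) ≤ H * (d ^ θ * s) := by
    have := (Nat.ceil_lt_add_one hpos.le).le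
    rw [hH, add_mul, one_mul]
    linarith
  refine (hx h hh0).trans ?_
  have t1 : (h : ℝ) ^ m * (K / s ^ m) ≤ H ^ m * K * 2 ^ (m * θ - e) * d ^ e := by
    calc (h : ℝ) ^ m * (K / s ^ m) ≤ (H * (d ^ θ * s)) ^ m * (K / s ^ m) := by gcongr
      _ = H ^ m * K * d ^ (m * θ) := by
        rw [mul_comm (m : ℝ), Real.rpow_mul hd.le, Real.rpow_natCast]
        field_simp
        rw [mul_pow, mul_pow]
        ring
      _ ≤ H ^ m * K * (2 ^ (m * θ - e) * d ^ e) := by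
        gcongr
        exact rpow_le_mul_rpow hd hd2 hm
      _ = _ := by ring
  have t2 : p ≤ M * (1 / c) ^ q * 2 ^ (q - e) * d ^ e := by
    calc p ≤ M * (1 / s) ^ q := hp
      _ ≤ M * (d / c) ^ q := by
        gcongr
        linarith
      _ = M * (1 / c) ^ q * d ^ q := by
        rw [div_eq_mul_one_div, Real.mul_rpow hd.le (by positivity)]; ring
      _ ≤ M * (1 / c) ^ q * (2 ^ (q - e) * d ^ e) := by
        gcongr
        exact rpow_le_mul_rpow hd hd2 hq
      _ = _ := by ring
  have t3 := hR h hle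
  calc (2 * (h : ℝ)) ^ m * (K / s ^ m) + 2 ^ m * p + 2 ^ m * R h
      = 2 ^ m * ((h : ℝ) ^ m * (K / s ^ m) + p + R h) := by rw [mul_pow]; ring
    _ ≤ 2 ^ m * (H ^ m * K * 2 ^ (m * θ - e) * d ^ e + M * (1 / c) ^ q * 2 ^ (q - e) * d ^ e
        + C * d ^ e) := by gcongr
    _ = _ := by ring

/-! ### Rates for one pair of laws -/

/-- The constant `c` for which a standardised lattice law with span `1 / s` has distance at
least `c / s` from the normal law. -/
def latticeConst : ℝ := gaussianPDFReal 0 1 2 / 8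

lemma latticeConst_pos : 0 < latticeConst :=
  div_pos (gaussianPDFReal_pos 0 1 2 one_ne_zero) (by norm_num)

/-- The factor lost when the normal law is replaced by the translated Poisson law. -/
def poissonConst : ℝ := 1 + 181 / latticeConst

lemma poissonConst_pos : 0 < poissonConst := by
  have := latticeConst_pos
  unfold poissonConst
  positivity

lemma add_div_le_poissonConst_mul {d s : ℝ} (h : latticeConst / s ≤ d) :
    d + 181 / s ≤ poissonConst * d := by
  have hc := latticeConst_pos
  have : 181 / s ≤ 181 / latticeConst * d := by
    calc 181 / s = 181 / latticeConst * (latticeConst / s) := by field_simp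
      _ ≤ 181 / latticeConst * d := by gcongr
  rw [poissonConst]
  linarith

section

variable {μ : Measure ℤ} [IsProbabilityMeasure μ] {a s : ℝ}

lemma supBound_intCdf_sub_translatedPoisson (hs : 1 ≤ s) :
    SupBound (fun j => intCdf μ j - intCdf (translatedPoisson a (s ^ 2)) j)
      (poissonConst * dK (stdLaw μ a s) (gaussianReal 0 1)) := by
  obtain ⟨r, h1, h2, hr⟩ := exists_stdLaw_translatedPoisson a s
  refine SupBound.mono (abs_intCdf_sub_le a (by linarith) (abs_cdf_sub_le_dK _ _) fun x => ?_)
    (add_div_le_poissonConst_mul (le_dK_stdLaw a hs))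
  rw [hr]
  exact abs_cdf_poisson_sub_gaussian_le hs h1 h2 x

lemma l1Bound_intCdf_sub_translatedPoisson (hs : 1 ≤ s)
    (hμ : Integrable (fun t : ℝ => t) (stdLaw μ a s)) :
    L1Bound (fun j => intCdf μ j - intCdf (translatedPoisson a (s ^ 2)) j)
      (s * (poissonConst * dW (stdLaw μ a s) (gaussianReal 0 1))) := by
  obtain ⟨r, h1, h2, hr⟩ := exists_stdLaw_translatedPoisson a s
  have hν := integrable_stdLaw_translatedPoisson a s
  refine L1Bound.mono (l1Bound_intCdf_sub a (by linarith) (integrable_cdf_sub_cdf hμ hν)) ?_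
  refine mul_le_mul_of_nonneg_left ?_ (by linarith)
  refine (dW_triangle hμ hν integrable_id_gaussian).trans
    (le_trans ?_ (add_div_le_poissonConst_mul (le_dW_stdLaw a hs hμ)))
  gcongr
  rw [hr]
  exact dW_poisson_gaussian_le hs h1 h2

lemma smoothBy_translatedPoisson_sq (hs : 0 < s) {n : ℕ} (hn : 0 < n) :
    SmoothBy (translatedPoisson a (s ^ 2)) ((Polynomial.X - 1) ^ n) (√n ^ n / s ^ n) := by
  have := smoothBy_translatedPoisson a (by positivity : 0 < s ^ 2) hn
  rwa [Real.sqrt_div' _ (by positivity), Real.sqrt_sq hs.le, div_pow] at this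

end

lemma dTV_nonneg (μ ν : Measure ℤ) : 0 ≤ dTV μ ν :=
  mul_nonneg (by norm_num) (tsum_nonneg fun _ => abs_nonneg _)

lemma dLoc_nonneg (μ ν : Measure ℤ) : 0 ≤ dLoc μ ν :=
  Real.iSup_nonneg fun _ => abs_nonneg _

/-- If `h ≥ d ^ θ s`, an `n`-th order loss `(s / h) ^ n` costs at most a factor `d ^ (-n θ)`. -/
lemma mul_div_pow_le {d s θ c : ℝ} (hd : 0 < d) (hs : 0 < s) (hc : 0 ≤ c) (n : ℕ) {h : ℕ}
    (hh : d ^ θ * s ≤ h) : c * d * (s / h) ^ n ≤ c * d ^ (1 - n * θ) := by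
  have hp : 0 < d ^ θ * s := by positivity
  have h1 : (s / h) ≤ d ^ (-θ) := by
    rw [div_le_iff₀ (hp.trans_le hh)]
    calc s = d ^ (-θ) * (d ^ θ * s) := by
          rw [← mul_assoc, ← Real.rpow_add hd, neg_add_cancel, Real.rpow_zero, one_mul]
      _ ≤ d ^ (-θ) * h := by gcongr
  calc c * d * (s / h) ^ n ≤ c * d * (d ^ (-θ)) ^ n := by gcongr
    _ = c * (d ^ (1 : ℝ) * d ^ (-θ * n)) := by
      rw [Real.rpow_mul hd.le, Real.rpow_natCast, Real.rpow_one, mul_assoc]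
    _ = c * d ^ (1 - n * θ) := by
      rw [← Real.rpow_add hd]
      ring_nf

/-- The part of the bound for the local metric that is common to both distances: `x = s · dLoc`. -/
lemma mul_dLoc_le {μ μ₁ μ₂ ν : Measure ℤ} [IsFiniteMeasure μ₁] [IsFiniteMeasure μ₂]
    [IsFiniteMeasure ν] {s K₁ K₂ R : ℝ} {m h : ℕ} (hs : 0 < s)
    (hμ : intCdf μ = intCdf μ₁ + intCdf μ₂)
    (h₁ : SmoothBy μ₁ ((Polynomial.X - 1) ^ (m + 1)) (K₁ / s ^ (m + 1)))
    (h₂ : SmoothBy ν ((Polynomial.X - 1) ^ (m + 1)) (K₂ / s ^ (m + 1))) (hh : 0 < h)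
    (hR : SupBound (shiftAct (movAvg h ^ 2 * (Polynomial.X - 1))
      (fun j => intCdf μ j - intCdf ν j)) R) :
    s * dLoc μ ν ≤ (2 * h) ^ m * ((K₁ + K₂) / s ^ m) + 2 ^ m * (s * μ₂.real Set.univ) +
      2 ^ m * (s * R) := by
  refine (mul_le_mul_of_nonneg_left (dLoc_le_of_smoothBy hμ h₁ h₂ hh hR) hs.le).trans_eq ?_
  field_simp
  ring

lemma mul_one_div_rpow_le {M k s p : ℝ} (hs : 0 < s) (hp : p ≤ M * (1 / s) ^ k) :
    s * p ≤ M * (1 / s) ^ (k - 1) := by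
  rw [Real.rpow_sub (by positivity), Real.rpow_one]
  calc s * p ≤ s * (M * (1 / s) ^ k) := by gcongr
    _ = _ := by field_simp

section

variable {k K M : ℝ} {n m : ℕ}

lemma exists_dTV_le (hk : 1 ≤ k) (hn : k ≤ n) (hK : 0 ≤ K) (hM : 0 ≤ M) :
    ∃ C, ∀ (μ μ₁ μ₂ : Measure ℤ) (a s : ℝ), IsProbabilityMeasure μ → IsFiniteMeasure μ₁ →
      IsFiniteMeasure μ₂ → 1 ≤ s → intCdf μ = intCdf μ₁ + intCdf μ₂ →
      Integrable (fun t : ℝ => t) (stdLaw μ a s) →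
      dW (stdLaw μ a s) (gaussianReal 0 1) ≤ 2 →
      SmoothBy μ₁ ((Polynomial.X - 1) ^ n) (K / s ^ n) → μ₂.real Set.univ ≤ M * (1 / s) ^ k →
      dTV μ (translatedPoisson a (s ^ 2)) ≤
        C * dW (stdLaw μ a s) (gaussianReal 0 1) ^ (k / (k + 1)) := by
  have hn0 : 0 < n := by
    have : (0 : ℝ) < n := by linarith
    exact_mod_cast this
  obtain ⟨C, hC⟩ := exists_rate (θ := 1 / (k + 1)) (e := k / (k + 1)) (q := k) (m := n)
    (K := K + √n ^ n) (M := M) (C := 2 * poissonConst) latticeConst_pos (by positivity)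
    (by rw [div_le_one (by linarith)]; linarith)
    (by rw [mul_one_div]; gcongr) (by positivity)
    (by rw [div_le_iff₀ (by linarith)]; nlinarith) (by positivity) hM
  refine ⟨C / 2, fun μ μ₁ μ₂ a s _ _ _ hs hμ hi h2 h₁ hp => ?_⟩
  have hs0 : 0 < s := by linarith
  have hd := le_dW_stdLaw a hs hi
  have hd0 := (div_pos latticeConst_pos hs0).trans_le hd
  have hA := l1Bound_intCdf_sub_translatedPoisson (a := a) hs hi
  set d := dW (stdLaw μ a s) (gaussianReal 0 1)
  have := hC d s (2 * dTV μ (translatedPoisson a (s ^ 2))) (μ₂.real Set.univ)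
    (fun h => 2 / h * (s * (poissonConst * d))) hs hd h2 hp (fun h hh => ?_) fun h hh => ?_
  · linarith
  · have := mul_div_pow_le hd0 hs0 (by linarith [poissonConst_pos] : 0 ≤ 2 * poissonConst) 1 hh
    have e : 1 - ((1 : ℕ) : ℝ) * (1 / (k + 1)) = k / (k + 1) := by
      push_cast
      field_simp
      ring
    rw [e] at this
    refine le_of_eq_of_le ?_ this
    ring
  · have := dTV_le_of_smoothBy hμ h₁ (smoothBy_translatedPoisson_sq hs0 hn0) hA hh
    rwa [← add_div] at this

lemma exists_dLoc_le_dK (hk : 2 ≤ k) (hn : k ≤ m + 1) (hK : 0 ≤ K) (hM : 0 ≤ M) :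
    ∃ C, ∀ (μ μ₁ μ₂ : Measure ℤ) (a s : ℝ), IsProbabilityMeasure μ → IsFiniteMeasure μ₁ →
      IsFiniteMeasure μ₂ → 1 ≤ s → intCdf μ = intCdf μ₁ + intCdf μ₂ →
      SmoothBy μ₁ ((Polynomial.X - 1) ^ (m + 1)) (K / s ^ (m + 1)) →
      μ₂.real Set.univ ≤ M * (1 / s) ^ k →
      dLoc μ (translatedPoisson a (s ^ 2)) ≤
        C * (dK (stdLaw μ a s) (gaussianReal 0 1) ^ (1 - 1 / k) / s) := by
  have hk0 : 0 < k := by linarith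
  have he : 1 - 1 / k = (k - 1) / k := by field_simp
  obtain ⟨C, hC⟩ := exists_rate (θ := 1 / k) (e := 1 - 1 / k) (q := k - 1) (m := m)
    (K := K + √(m + 1 : ℕ) ^ (m + 1)) (M := M) (C := 2 * poissonConst) latticeConst_pos
    (by positivity) (by rw [div_le_one hk0]; linarith)
    (by rw [mul_one_div, he]; gcongr; linarith)
    (by rw [he]; exact div_nonneg (by linarith) (by linarith))
    (by rw [he, div_le_iff₀ hk0]; nlinarith) (by positivity) hM
  refine ⟨C, fun μ μ₁ μ₂ a s _ _ _ hs hμ h₁ hp => ?_⟩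
  have hs0 : 0 < s := by linarith
  have hd := le_dK_stdLaw (μ := μ) a hs
  have hd0 := (div_pos latticeConst_pos hs0).trans_le hd
  have hA := supBound_intCdf_sub_translatedPoisson (μ := μ) (a := a) hs
  have h2 := (dK_le_one (stdLaw μ a s) (gaussianReal 0 1)).trans one_le_two
  set d := dK (stdLaw μ a s) (gaussianReal 0 1)
  have := hC d s (s * dLoc μ (translatedPoisson a (s ^ 2))) (s * μ₂.real Set.univ)
    (fun h => s * (2 / h * (poissonConst * d))) hs hd h2 (mul_one_div_rpow_le hs0 hp)
    (fun h hh => ?_) fun h hh => ?_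
  · rwa [← mul_div_assoc, le_div_iff₀ hs0, mul_comm]
  · have := mul_div_pow_le hd0 hs0 (by linarith [poissonConst_pos] : 0 ≤ 2 * poissonConst) 1 hh
    rw [Nat.cast_one, one_mul] at this
    refine le_of_eq_of_le ?_ this
    ring
  · exact mul_dLoc_le hs0 hμ h₁ (smoothBy_translatedPoisson_sq hs0 m.succ_pos) hh
      (opBound_movAvg_sq_mul isShiftNorm_supBound hh _ _ hA)

lemma exists_dLoc_le_dW (hk : 2 ≤ k) (hn : k ≤ m + 1) (hK : 0 ≤ K) (hM : 0 ≤ M) :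
    ∃ C, ∀ (μ μ₁ μ₂ : Measure ℤ) (a s : ℝ), IsProbabilityMeasure μ → IsFiniteMeasure μ₁ →
      IsFiniteMeasure μ₂ → 1 ≤ s → intCdf μ = intCdf μ₁ + intCdf μ₂ →
      Integrable (fun t : ℝ => t) (stdLaw μ a s) →
      dW (stdLaw μ a s) (gaussianReal 0 1) ≤ 2 →
      SmoothBy μ₁ ((Polynomial.X - 1) ^ (m + 1)) (K / s ^ (m + 1)) →
      μ₂.real Set.univ ≤ M * (1 / s) ^ k →
      dLoc μ (translatedPoisson a (s ^ 2)) ≤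
        C * (dW (stdLaw μ a s) (gaussianReal 0 1) ^ (1 - 2 / (k + 1)) / s) := by
  have hk0 : 0 < k + 1 := by linarith
  have he : 1 - 2 / (k + 1) = (k - 1) / (k + 1) := by field_simp; ring
  obtain ⟨C, hC⟩ := exists_rate (θ := 1 / (k + 1)) (e := 1 - 2 / (k + 1)) (q := k - 1) (m := m)
    (K := K + √(m + 1 : ℕ) ^ (m + 1)) (M := M) (C := 2 * poissonConst) latticeConst_pos
    (by positivity) (by rw [div_le_one hk0]; linarith)
    (by rw [mul_one_div, he]; gcongr; linarith)
    (by rw [he]; exact div_nonneg (by linarith) (by linarith))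
    (by rw [he, div_le_iff₀ hk0]; nlinarith) (by positivity) hM
  refine ⟨C, fun μ μ₁ μ₂ a s _ _ _ hs hμ hi h2 h₁ hp => ?_⟩
  have hs0 : 0 < s := by linarith
  have hd := le_dW_stdLaw a hs hi
  have hd0 := (div_pos latticeConst_pos hs0).trans_le hd
  have hA := l1Bound_intCdf_sub_translatedPoisson (a := a) hs hi
  set d := dW (stdLaw μ a s) (gaussianReal 0 1)
  have := hC d s (s * dLoc μ (translatedPoisson a (s ^ 2))) (s * μ₂.real Set.univ)
    (fun h => s * (2 * (s * (poissonConst * d)) / h ^ 2)) hs hd h2 (mul_one_div_rpow_le hs0 hp)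
    (fun h hh => ?_) fun h hh => ?_
  · rwa [← mul_div_assoc, le_div_iff₀ hs0, mul_comm]
  · have := mul_div_pow_le hd0 hs0 (by linarith [poissonConst_pos] : 0 ≤ 2 * poissonConst) 2 hh
    rw [Nat.cast_two, mul_one_div] at this
    refine le_of_eq_of_le ?_ this
    ring
  · exact mul_dLoc_le hs0 hμ h₁ (smoothBy_translatedPoisson_sq hs0 m.succ_pos) hh
      (supBound_movAvg_sq_mul hh hA)

end

/-! ### The family of random variables -/

section

variable {Ω : Type*} [MeasurableSpace Ω] {P : Measure Ω} {W : Ω → ℤ}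

lemma map_standardize (hW : Measurable W) (a s : ℝ) :
    P.map (fun ω => ((W ω : ℝ) - a) / s) = stdLaw (P.map W) a s := by
  rw [stdLaw, Measure.map_map .of_discrete hW]
  rfl

lemma intCdf_map_eq_add [IsFiniteMeasure P] (hW : Measurable W) {s : Set Ω}
    (hs : MeasurableSet s) :
    intCdf (P.map W) = intCdf ((P.restrict s).map W) + intCdf ((P.restrict sᶜ).map W) := by
  ext j
  have h := Measure.restrict_add_restrict_compl (μ := P) hs
  simp only [Pi.add_apply, intCdf]
  rw [← measureReal_add_apply, ← Measure.map_add _ _ hW, h]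

lemma integrable_stdLaw [IsProbabilityMeasure P] (hW : Measurable W)
    (hL2 : MemLp (fun ω => (W ω : ℝ)) 2 P) (a s : ℝ) :
    Integrable (fun t : ℝ => t) (stdLaw (P.map W) a s) := by
  rw [← map_standardize hW, integrable_map_measure (by fun_prop) (by fun_prop)]
  exact ((hL2.integrable one_le_two).sub (integrable_const a)).div_const s

lemma dW_stdLaw_le_two [IsProbabilityMeasure P] (hW : Measurable W)
    (hL2 : MemLp (fun ω => (W ω : ℝ)) 2 P) {s : ℝ} (hs : 0 < s)
    (hvar : variance (fun ω => (W ω : ℝ)) P = s ^ 2) :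
    dW (stdLaw (P.map W) (∫ ω, (W ω : ℝ) ∂P) s) (gaussianReal 0 1) ≤ 2 := by
  have := Measure.isProbabilityMeasure_map (μ := P) hW.aemeasurable
  have h2 := (hL2.sub (memLp_const (∫ ω, (W ω : ℝ) ∂P))).integrable_sq
  refine dW_gaussian_le_two (integrable_stdLaw hW hL2 _ _) ?_ ?_
  · rw [← map_standardize hW, integrable_map_measure (by fun_prop) (by fun_prop)]
    refine (h2.div_const (s ^ 2)).congr (ae_of_all _ fun ω => ?_)
    simp [div_pow]
  · rw [← map_standardize hW, integral_map (by fun_prop) (by fun_prop)]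
    rw [variance_eq_integral (by fun_prop)] at hvar
    simp only [div_pow, integral_div, hvar]
    field_simp

end

lemma isBigO_of_eventually_le {ι : Type*} {l : Filter ι} {f g : ι → ℝ} {C : ℝ} (hf : ∀ i, 0 ≤ f i)
    (h : ∀ᶠ i in l, f i ≤ C * g i) : f =O[l] g := by
  refine IsBigO.of_bound |C| (h.mono fun i hi => ?_)
  rw [Real.norm_of_nonneg (hf i), Real.norm_eq_abs, ← abs_mul]
  exact hi.trans (le_abs_self _)

end

theorem theorem5 {ι : Type*} (l : Filter ι)
    (Ω : ι → Type*) (𝓕 : ∀ i, MeasurableSpace (Ω i)) [mΩ : ∀ i, MeasurableSpace (Ω i)]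
    (h𝓕 : ∀ i, 𝓕 i ≤ mΩ i)
    (P : ∀ i, Measure (Ω i)) [∀ i, IsProbabilityMeasure (P i)]
    -- the family `W = W(σ)`, with `σ → ∞` along `l`
    (σ : ι → ℝ) (hσ : Tendsto σ l atTop)
    (W : ∀ i, Ω i → ℤ) (hW : ∀ i, Measurable (W i))
    (hWL2 : ∀ i, MemLp (fun ω => (W i ω : ℝ)) 2 (P i))
    (hWvar : ∀ i, variance (fun ω => (W i ω : ℝ)) (P i) = σ i ^ 2)
    -- the decomposition `W = Y + ∑_{j < N} Z_j`
    (N : ∀ i, Ω i → ℕ) (hN : ∀ i, Measurable[𝓕 i] (N i))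
    (Y : ∀ i, Ω i → ℤ) (hY : ∀ i, Measurable (Y i))
    (Z : ∀ i, ℕ → Ω i → ℤ) (hZ : ∀ i j, Measurable (Z i j))
    (hdecomp : ∀ i, ∀ᵐ ω ∂(P i), W i ω = Y i ω + ∑ j ∈ Finset.range (N i ω), Z i j ω)
    -- conditionally on `𝓕`, the variables `Y, Z_0, …, Z_{N-1}` are independent
    (hindep : ∀ i, ∀ᵐ ω ∂(P i), iIndepFun (blockCoord (N i ω))
      (condLaw (𝓕 i) (P i) (fun ω' => (Y i ω', fun j => Z i j ω')) ω))
    -- conditionally on `𝓕`, `u ≤ 1 - D₁(Z_j) / 2` for all `j < N`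
    (u β : ℝ) (hu : 0 < u) (hβ : 0 < β)
    (hsmooth : ∀ i, ∀ᵐ ω ∂(P i), ∀ j < N i ω,
      u ≤ 1 - 1 / 2 * smoothD 1 (condLaw (𝓕 i) (P i) (Z i j) ω)) :
    (∀ k : ℝ, 2 ≤ k →
      (fun i => (P i).real {ω | (N i ω : ℝ) < β * σ i ^ 2}) =O[l] (fun i => σ i ^ (-k)) →
      ((fun i => dLoc ((P i).map (W i)) (translatedPoisson (∫ ω, (W i ω : ℝ) ∂(P i)) (σ i ^ 2)))
          =O[l] fun i =>
            dK ((P i).map (fun ω => ((W i ω : ℝ) - ∫ ω', (W i ω' : ℝ) ∂(P i)) / σ i))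
              (gaussianReal 0 1) ^ (1 - 1 / k) / σ i) ∧
      ((fun i => dLoc ((P i).map (W i)) (translatedPoisson (∫ ω, (W i ω : ℝ) ∂(P i)) (σ i ^ 2)))
          =O[l] fun i =>
            dW ((P i).map (fun ω => ((W i ω : ℝ) - ∫ ω', (W i ω' : ℝ) ∂(P i)) / σ i))
              (gaussianReal 0 1) ^ (1 - 2 / (k + 1)) / σ i)) ∧
    (∀ k : ℝ, 1 ≤ k →
      (fun i => (P i).real {ω | (N i ω : ℝ) < β * σ i ^ 2}) =O[l] (fun i => σ i ^ (-k)) →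
      (fun i => dTV ((P i).map (W i)) (translatedPoisson (∫ ω, (W i ω : ℝ) ∂(P i)) (σ i ^ 2)))
          =O[l] fun i =>
            dW ((P i).map (fun ω => ((W i ω : ℝ) - ∫ ω', (W i ω' : ℝ) ∂(P i)) / σ i))
              (gaussianReal 0 1) ^ (k / (k + 1))) := by
  have hprob : ∀ i, IsProbabilityMeasure ((P i).map (W i)) := fun i =>
    Measure.isProbabilityMeasure_map (hW i).aemeasurable
  have hσ1 : ∀ᶠ i in l, 1 ≤ σ i := hσ.eventually_ge_atTop 1
  -- the law of `W` splits into its parts on the good event `β σ² ≤ N` and on its complement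
  set G : ∀ i, Set (Ω i) := fun i => {ω | β * σ i ^ 2 ≤ N i ω} with hG
  have hGm : ∀ i, MeasurableSet (G i) := fun i =>
    measurableSet_le measurable_const
      (measurable_from_nat.comp ((hN i).mono (h𝓕 i) le_rfl) : Measurable fun ω => (N i ω : ℝ))
  have hcdf := fun i => intCdf_map_eq_add (P := P i) (hW i) (hGm i)
  have hbad : ∀ i, (((P i).restrict (G i)ᶜ).map (W i)).real Set.univ =
      (P i).real {ω | (N i ω : ℝ) < β * σ i ^ 2} := by
    intro i
    rw [map_measureReal_apply (hW i) .univ, Set.preimage_univ, measureReal_restrict_apply_univ]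
    congr 1
    ext ω
    simp [hG]
  have hgood : ∀ i, 0 < σ i → ∀ n : ℕ, 0 < n → SmoothBy (((P i).restrict (G i)).map (W i))
      ((Polynomial.X - 1) ^ n) (√(8 * n / (min u 1 * β)) ^ n / σ i ^ n) := by
    intro i hs n hn
    -- a value `u > 1` is only possible where `N = 0`, so `u` may be lowered to `min u 1`
    have hu' : 0 < min u 1 := lt_min hu one_pos
    have h := smoothBy_map_restrict (𝓕 i) (h𝓕 i) (P i) (hW i) (hN i) (hY i) (hZ i) (hdecomp i)
      (hindep i) hu' (min_le_right u 1) (t := β * σ i ^ 2) (by positivity)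
      ((hsmooth i).mono fun ω hω j hj => (min_le_left u 1).trans (hω j hj)) hn
    rwa [← mul_assoc, ← div_div, Real.sqrt_div' _ (by positivity), Real.sqrt_sq hs.le,
      div_pow] at h
  have hi := fun i => integrable_stdLaw (hW i) (hWL2 i) (∫ ω, (W i ω : ℝ) ∂(P i)) (σ i)
  have htail : ∀ k : ℝ,
      (fun i => (P i).real {ω | (N i ω : ℝ) < β * σ i ^ 2}) =O[l] (fun i => σ i ^ (-k)) →
      ∃ M, 0 ≤ M ∧ ∀ᶠ i in l, (((P i).restrict (G i)ᶜ).map (W i)).real Set.univ ≤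
        M * (1 / σ i) ^ k := by
    intro k hk
    obtain ⟨M, hM, h⟩ := hk.exists_pos
    refine ⟨M, hM.le, ?_⟩
    filter_upwards [h.bound, hσ1] with i hb hs
    have hs0 : 0 < σ i := by linarith
    rw [hbad, one_div, Real.inv_rpow hs0.le, ← Real.rpow_neg hs0.le]
    rwa [Real.norm_of_nonneg measureReal_nonneg, Real.norm_of_nonneg (by positivity)] at hb
  simp only [map_standardize (hW _)]
  refine ⟨fun k hk htl => ?_, fun k hk htl => ?_⟩
  · obtain ⟨M, hM, hp⟩ := htail k htl
    have hm : k ≤ (⌈k⌉₊ : ℕ) + 1 := (Nat.le_ceil k).trans (by linarith)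
    set m := ⌈k⌉₊
    have hK : 0 ≤ √(8 * (m + 1 : ℕ) / (min u 1 * β)) ^ (m + 1) := by positivity
    obtain ⟨C₁, h₁⟩ := exists_dLoc_le_dK hk hm hK hM
    obtain ⟨C₂, h₂⟩ := exists_dLoc_le_dW hk hm hK hM
    constructor
    · refine isBigO_of_eventually_le (C := C₁) (fun _ => dLoc_nonneg _ _) ?_
      filter_upwards [hσ1, hp] with i hs hpi
      exact h₁ _ _ _ _ _ (hprob i) inferInstance inferInstance hs (hcdf i)
        (hgood i (by linarith) _ m.succ_pos) hpi
    · refine isBigO_of_eventually_le (C := C₂) (fun _ => dLoc_nonneg _ _) ?_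
      filter_upwards [hσ1, hp] with i hs hpi
      exact h₂ _ _ _ _ _ (hprob i) inferInstance inferInstance hs (hcdf i) (hi i)
        (dW_stdLaw_le_two (hW i) (hWL2 i) (by linarith) (hWvar i))
        (hgood i (by linarith) _ m.succ_pos) hpi
  · obtain ⟨M, hM, hp⟩ := htail k htl
    have hn := Nat.le_ceil k
    have hn0 : 0 < ⌈k⌉₊ := Nat.ceil_pos.2 (by linarith)
    set n := ⌈k⌉₊
    obtain ⟨C, h⟩ := exists_dTV_le hk hn
      (by positivity : 0 ≤ √(8 * n / (min u 1 * β)) ^ n) hM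
    refine isBigO_of_eventually_le (C := C) (fun _ => dTV_nonneg _ _) ?_
    filter_upwards [hσ1, hp] with i hs hpi
    exact h _ _ _ _ _ (hprob i) inferInstance inferInstance hs (hcdf i) (hi i)
      (dW_stdLaw_le_two (hW i) (hWL2 i) (by linarith) (hWvar i)) (hgood i (by linarith) _ hn0) hpi
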